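/- **Setting.** A Dubins vehicle moves in the plane with constant speed $v>0$: $\dot{\boldsymbol r}=v\vec e(\theta)$, $\vec e(\theta)=(\cos\theta,\sin\theta)^{\top}$, $\dot\theta=u$, $|u|\le\bar u$ ($\bar u>0$), $\boldsymbol r(0)=\boldsymbol r_{\rm in}$, $\theta(0)=\theta_{\rm in}$. A time-varying scalar field $D(t,\boldsymbol r)$ is given; $d(t):=D(t,\boldsymbol r(t))$ is the field value at the vehicle's location. The vehicle is driven by the sliding-mode law $$u=-\bar u\,\operatorname{sgn}\{\dot d+\chi(d-d_0)\},\qquad \chi(p)=\gamma p\ \text{ if } |p|\le\delta,\quad \chi(p)=\gamma\delta\operatorname{sgn}p\ \text{ otherwise},$$ with $\gamma,\delta>0$. Motions are understood in Filippov's sense: $u$ is locally integrable, $|u|\le \bar u$, and for almost all $t$ the law holds whenever $\dot d+\chi(d-d_0)\ne0$. **Notation.** For $(t,\boldsymbol r)$ with $\nabla D\ne0$ ($\nabla$ is the spatial gradient) let $N=\nabla D/\|\nabla D\|$ and let $T$ be the unit tangent of the isoline $\{D(t,\cdot)=D(t,\boldsymbol r)\}$ having the domain of greater values to the left. Let $p(h)$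 be the ordinate of the point, nearest to $\boldsymbol r$, where the line $\{\boldsymbol r+pN\}$ meets the displaced isoline $\{D(t+h,\cdot)=D(t,\boldsymbol r)\}$, and let $\boldsymbol r_+(h)=\boldsymbol r+p(h)N$; let $q(g)$ be the analogous ordinate for the isoline $\{D(t,\cdot)=D(t,\boldsymbol r)+g\}$. Define, at $(t,\boldsymbol r)$: * the front velocity $\lambda=\lim_{h\to0}p(h)/h$ and the front acceleration $\alpha=\lim_{h\to0}\frac{\lambda(t+h,\boldsymbol r_+(h))-\lambda(t,\boldsymbol r)}{h}$; * the angular velocity $\omega$ of the isoline, i.e. the limit as $h\to0$ of $1/h$ times the angle from $T(t,\boldsymbol r)$ to $T(t+h,\boldsymbol r_+(h))$, and the signed curvature $\varkappa$ of the isoline (with respect to $T,N$); * the density of isolines $\rho=\lim_{g\to0}g/q(g)$ and its proportional growth rates $v_\rho=\frac1\rho\lim_{h\to0}\frac{\rho(t+h,\boldsymbol r_+(h))-\rho(t,\boldsymbol r)}{h}$, $\tau_\rho=\frac1\rho\lim_{s\to0}\frac{\rho(t,\boldsymbol r+sT)-\rho(t,\boldsymbol r)}{s}$, $n_\rho=\frac1\rho\lim_{s\to0}\frac{\rho(t,\boldsymbol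 r+sN)-\rho(t,\boldsymbol r)}{s}$. **Assumptions.** Let $d_-\le d_0\le d_+$ and let $\mathcal M=\{(t,\boldsymbol r): t\ge0,\ d_-\le D(t,\boldsymbol r)\le d_+\}$ be the operational zone. Suppose that: 1. $\mathcal M$ is closed (which is automatic if $D$ is continuous), $D$ is twice continuously differentiable in a neighbourhood of every point of $\mathcal M$, and there are $\Delta_\lambda,\Delta_u>0$ such that on $\mathcal M$, with both signs in $\pm$, $$|\lambda|\le v-\Delta_\lambda,\qquad \Bigl|\pm2\omega+\frac{\alpha}{\sqrt{v^2-\lambda^2}}+\varkappa\sqrt{v^2-\lambda^2}\Bigr|\le\bar u-\Delta_u .$$ 2. There is $b_\rho>0$ such that $\|\nabla D\|\ge b_\rho^{-1}$ on $\mathcal M$. 3. There are constants such that $|\lambda|\le b_\lambda$, $|\tau_\rho|\le b_\tau$, $|n_\rho|\le b_n$, $|\varkappa|\le b_\varkappa$, $|v_\rho|\le b_v$, $|\alpha|\le b_\alpha$ on $\mathcal M$. 4. There is a natural $k$ such that, with $T_k=2\pi k/\bar u$, (a) during $[0,T_k]$ the gradient $\nabla D(t,\boldsymbol r_{\rm in})$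 rotates through an angle (total increment of its continuous polar angle, in absolute value) not exceeding $2\pi(k-1)$, and (b) $[0,T_k]\times D_\pm\subset\mathcal M$, where $D_\pm$ are the closed discs encircled by the paths of the vehicle that start at $\boldsymbol r_{\rm in}$ with the heading $\theta_{\rm in}$ and have $u\equiv\pm\bar u$. Let $\mu=\gamma\delta$, $\mu_*=b_\rho\mu$, $\sigma(\mu_*)=\sqrt{\Delta_\lambda^2-2v\mu_*-\mu_*^2}$, and let the parameters of the controller satisfy $$0<\mu_*<\sqrt{v^2+\Delta_\lambda^2}-v,\qquad \Bigl(3b_\tau+\frac{v\,b_\varkappa+2b_v+\gamma+b_n\mu_*}{\sigma(\mu_*)}+\frac{v\,b_\alpha}{\sigma(\mu_*)^3}\Bigr)\mu_*<\Delta_u .$$ **Theorem.** Consider any motion of the vehicle driven by the above law; in the exceptional case where at $t=0$ both $\dot d+\chi(d-d_0)=0$ and $\langle\vec e(\theta_{\rm in}),T(0,\boldsymbol r_{\rm in})\rangle<0$ (the repelling part of the discontinuity surface), suppose that $\dot d+\chi(d-d_0)\neq0$ on some interval $(0,\varepsilon)$, i.e. that the motion leaves this surface at once. Then $(t,\boldsymbol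 r(t))\in\mathcal M$ at all times at which the motion is defined, and $d(t)\to d_0$ as $t\to\infty$ if it is defined on $[0,\infty)$. -/

import Mathlib

open Set Filter Topology MeasureTheory

noncomputable section

namespace IsolineTracking

/-! The plane is identified with `ℂ` (as a real Euclidean plane): the point `(x, y)` is
`x + i y`, multiplication by `I` is the counter-clockwise rotation through `π / 2`, and the unit
vector `(cos θ, sin θ)` is `exp (θ i)`.  A field is a function `D : ℝ → ℂ → ℝ` of the time and of
the point.

Every limit below exists, as an ordinary finite limit, at each point near which `D` is twice
continuously differentiable and where its spatial gradient does not vanish. -/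

/-- The unit vector with polar angle `θ`. -/
def dir (θ : ℝ) : ℂ := Complex.exp (θ * Complex.I)

/-- The spatial gradient `∇D(t, r)`. -/
def grad (D : ℝ → ℂ → ℝ) (t : ℝ) (r : ℂ) : ℂ := gradient (D t) r

/-- The unit normal `N = ∇D / ‖∇D‖` of the spatial isoline through `r`. -/
def normal (D : ℝ → ℂ → ℝ) (t : ℝ) (r : ℂ) : ℂ := (‖grad D t r‖ : ℂ)⁻¹ * grad D t r

/-- The unit tangent `T` of the spatial isoline through `r`; the normal `N = I * T`, hence the
domain of greater values, is to the left of `T`. -/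
def tangent (D : ℝ → ℂ → ℝ) (t : ℝ) (r : ℂ) : ℂ := -Complex.I * normal D t r

/-- The ordinate of the point, nearest to `r`, where the ordinate axis `{r + p N(t, r)}` of the
Frenet frame at `(t, r)` meets the isoline `{D(t', ·) = c}`. (For `t'` close to `t` and `c` close
to `D(t, r)`, that point exists and is unique near a regular point.) -/
def ordinate (D : ℝ → ℂ → ℝ) (t : ℝ) (r : ℂ) (t' c : ℝ) : ℝ :=
  Classical.epsilon fun p : ℝ =>
    D t' (r + p * normal D t r) = c ∧
      ∀ q : ℝ, D t' (r + q * normal D t r) = c → |p| ≤ |q|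

/-- The ordinate `p(h | t, r)` for the isoline of the same field level, displaced during the
time `h`. -/
def displacement (D : ℝ → ℂ → ℝ) (t : ℝ) (r : ℂ) (h : ℝ) : ℝ :=
  ordinate D t r (t + h) (D t r)

/-- The point `r₊(h | t, r)` of the displaced isoline. -/
def frontPoint (D : ℝ → ℂ → ℝ) (t : ℝ) (r : ℂ) (h : ℝ) : ℂ :=
  r + displacement D t r h * normal D t r

/-- The front velocity `λ = lim p(h) / h` of the isoline. -/
def frontVelocity (D : ℝ → ℂ → ℝ) (t : ℝ) (r : ℂ) : ℝ :=
  limUnder (𝓝[≠] (0 : ℝ)) fun h => displacement D t r h / h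

/-- The front acceleration `α` of the isoline. -/
def frontAcceleration (D : ℝ → ℂ → ℝ) (t : ℝ) (r : ℂ) : ℝ :=
  limUnder (𝓝[≠] (0 : ℝ)) fun h =>
    (frontVelocity D (t + h) (frontPoint D t r h) - frontVelocity D t r) / h

/-- The angular velocity `ω` of rotation of the isoline: `Complex.arg (w / z)` is the angular
displacement (in `(-π, π]`) of `w` with respect to `z`. -/
def angularVelocity (D : ℝ → ℂ → ℝ) (t : ℝ) (r : ℂ) : ℝ :=
  limUnder (𝓝[≠] (0 : ℝ)) fun h =>
    Complex.arg (tangent D (t + h) (frontPoint D t r h) / tangent D t r) / h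

/-- The density `ρ` of the isolines: the limit of `g / q(g)`, where `q(g)` is the ordinate for
the isoline of the level `D(t, r) + g` at the same time. -/
def density (D : ℝ → ℂ → ℝ) (t : ℝ) (r : ℂ) : ℝ :=
  limUnder (𝓝[≠] (0 : ℝ)) fun g => g / ordinate D t r t (D t r + g)

/-- The evolutional proportional growth rate `v_ρ` of the density. -/
def densityRate (D : ℝ → ℂ → ℝ) (t : ℝ) (r : ℂ) : ℝ :=
  (density D t r)⁻¹ * limUnder (𝓝[≠] (0 : ℝ)) fun h =>
    (density D (t + h) (frontPoint D t r h) - density D t r) / h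

/-- The tangential proportional growth rate `τ_ρ` of the density. -/
def tangentialRate (D : ℝ → ℂ → ℝ) (t : ℝ) (r : ℂ) : ℝ :=
  (density D t r)⁻¹ * limUnder (𝓝[≠] (0 : ℝ)) fun s =>
    (density D t (r + s * tangent D t r) - density D t r) / s

/-- The normal proportional growth rate `n_ρ` of the density. -/
def normalRate (D : ℝ → ℂ → ℝ) (t : ℝ) (r : ℂ) : ℝ :=
  (density D t r)⁻¹ * limUnder (𝓝[≠] (0 : ℝ)) fun s =>
    (density D t (r + s * normal D t r) - density D t r) / s

/-- The signed curvature `ϰ` of the isoline, by the Frenet formula `dT/ds = ϰ N`: the derivative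
of the unit tangent field in the direction of travel `T`, projected on `N`. It is positive where
the domain of greater values is convex. -/
def curvature (D : ℝ → ℂ → ℝ) (t : ℝ) (r : ℂ) : ℝ :=
  inner ℝ (deriv (fun s : ℝ => tangent D t (r + s * tangent D t r)) 0) (normal D t r)

/-- The operational zone `M`: the times are nonnegative. -/
def zone (D : ℝ → ℂ → ℝ) (dlo dhi : ℝ) : Set (ℝ × ℂ) :=
  {p | 0 ≤ p.1 ∧ dlo ≤ D p.1 p.2 ∧ D p.1 p.2 ≤ dhi}

/-- The linear function with saturation `χ`. -/
def chi (γ δ p : ℝ) : ℝ := if |p| ≤ δ then γ * p else Real.sign p * (γ * δ)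

/-- The closed disc encircled by the path of the robot that starts at `rin` with the heading `θin`
and moves with the constant turning rate `u ≠ 0`. -/
def initialDisc (v : ℝ) (rin : ℂ) (θin u : ℝ) : Set ℂ :=
  Metric.closedBall (rin + ((v / u : ℝ) : ℂ) * (Complex.I * dir θin)) (v / |u|)

/-- The field value `d(t)` measured by the robot. -/
def reading (D : ℝ → ℂ → ℝ) (r : ℝ → ℂ) (t : ℝ) : ℝ := D t (r t)

/-- The switching quantity `ḋ(t) + χ(d(t) - d₀)` along the motion `r` on the time interval `J`. -/
def switching (D : ℝ → ℂ → ℝ) (γ δ d₀ : ℝ) (J : Set ℝ) (r : ℝ → ℂ) (t : ℝ) : ℝ :=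
  derivWithin (reading D r) J t + chi γ δ (reading D r t - d₀)

/-- `r` (position), `θ` (heading), `u` (turning rate) form a motion, on the time interval `J`
starting at `0`, of the Dubins vehicle of speed `v` driven by the discontinuous law
`u = -ubar * sgn (ḋ + χ(d - d₀))`. As usual for sliding mode control, the motion is understood in
the sense of Filippov: where the argument of `sgn` is zero, `u` may take any admissible value. -/
structure IsMotion (D : ℝ → ℂ → ℝ) (v ubar γ δ d₀ : ℝ) (rin : ℂ) (θin : ℝ) (J : Set ℝ)
    (r : ℝ → ℂ) (θ u : ℝ → ℝ) : Prop where
  initial : r 0 = rin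
  velocity : ∀ t ∈ J, HasDerivWithinAt r (v * dir (θ t)) J t
  integrable : ∀ t ∈ J, IntervalIntegrable u volume 0 t
  heading : ∀ t ∈ J, θ t = θin + ∫ s in (0 : ℝ)..t, u s
  bound : ∀ᵐ t ∂(volume.restrict J), |u t| ≤ ubar
  law_pos : ∀ᵐ t ∂(volume.restrict J), 0 < switching D γ δ d₀ J r t → u t = -ubar
  law_neg : ∀ᵐ t ∂(volume.restrict J), switching D γ δ d₀ J r t < 0 → u t = ubar

/-- The motion does not start with a slide along the part of the discontinuity surface that
repels on both sides: if it starts on this surface while travelling in the negative direction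
relative to the isoline, it leaves the surface at once, that is, it moves with `u = ubar` or
`u = -ubar` initially. -/
def NoRepellingStart (D : ℝ → ℂ → ℝ) (γ δ d₀ : ℝ) (rin : ℂ) (θin : ℝ) (J : Set ℝ)
    (r : ℝ → ℂ) : Prop :=
  switching D γ δ d₀ J r 0 = 0 → inner ℝ (dir θin) (tangent D 0 rin) < 0 →
    ∃ ε > 0, ∀ t ∈ J, 0 < t → t < ε → switching D γ δ d₀ J r t ≠ 0

/-- During `[0, τ]`, the gradient at the fixed point `r` rotates through an angle that does not
exceed `a` in absolute value: the total increment of a continuous polar angle `φ` of the gradient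
is at most `a`. -/
def GradientRotationLE (D : ℝ → ℂ → ℝ) (r : ℂ) (τ a : ℝ) : Prop :=
  ∃ φ : ℝ → ℝ, ContinuousOn φ (Icc 0 τ) ∧
    (∀ t ∈ Icc 0 τ, grad D t r = ‖grad D t r‖ * dir (φ t)) ∧ |φ τ - φ 0| ≤ a

end IsolineTracking

end

/-! Let `z` be the normal speed of the vehicle relative to the isoline, `C` its tangential speed
along `T`, and `S = ḋ + χ(d - d₀)`. Then `ḋ = ρ z`, and where the heading is differentiable `d̈ = P
+ u Q` with `Q = ρ C`. Expanding `P` in the Frenet frame expresses it through `α, ω, ϰ, v_ρ, τ_ρ,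
n_ρ` (`drift_eq`).

On the surface `S = 0` one has `|z| ≤ μ_*`, so the vehicle travels almost as if it followed its
isoline exactly. Assumption 1 bounds `P` in that ideal case, and the choice of gains absorbs the
deviation. This yields `|P| + γ|ḋ| < ubar |Q|` (`gain_inequality`, packaged in `Controlled`). Hence
the turning rate decides the sign of the rate of `S` near the surface. The part `Q > 0` attracts,
the part `Q < 0` repels, and `Q` never vanishes on the surface within the zone.

Sliding that has started on the attracting part inside the zone persists (`Motion.sliding`): `S`
cannot leave zero while `Q > 0`, and `ḋ = -χ(d - d₀)` keeps `d` between `d_-` and `d_+`. In this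
mode the error decays exponentially (`Motion.sliding_decay`).

It remains to reach that part. Off the surface the control is constant and the vehicle runs along
one of the two initial circles. In time `T_k` its heading makes `k` turns. By homotopy inside the
disc, the gradient along the circle rotates as much as at the fixed point `rin`, hence at most `k -
1` turns. So the heading takes every direction relative to the gradient (`exists_dir_eq_normal`).
Along `N` one has `S > 0`, along `-N` one has `S < 0`, so `S` changes sign by time `T_k`. A first
zero approached under the control that opposes `S` must lie on the attracting part
(`steer_pos_of_arrival`). -/

noncomputable section

namespace IsolineTracking

/-! ### Front velocity and density through the first derivatives of the field -/

section Characteristics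

/-- The field as a function on space-time. -/
def field (D : ℝ → ℂ → ℝ) (q : ℝ × ℂ) : ℝ := D q.1 q.2

/-- The spatial gradient as a function on space-time. -/
def gradAt (D : ℝ → ℂ → ℝ) (q : ℝ × ℂ) : ℂ := grad D q.1 q.2

/-- The space-time Hessian of the field. -/
def hess (D : ℝ → ℂ → ℝ) (q x y : ℝ × ℂ) : ℝ := fderiv ℝ (fderiv ℝ (field D)) q x y

/-- The field is twice continuously differentiable near the point, which is not spatially
singular. -/
def Regular (D : ℝ → ℂ → ℝ) (q : ℝ × ℂ) : Prop :=
  ContDiffAt ℝ 2 (field D) q ∧ gradAt D q ≠ 0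

variable {D : ℝ → ℂ → ℝ} {q : ℝ × ℂ} {t : ℝ} {r : ℂ}

lemma gradAt_eq_toDual_symm (h : DifferentiableAt ℝ (field D) q) :
    gradAt D q = (InnerProductSpace.toDual ℝ ℂ).symm
      ((fderiv ℝ (field D) q).comp (ContinuousLinearMap.inr ℝ ℝ ℂ)) := by
  have h1 : HasFDerivAt (D q.1) ((fderiv ℝ (field D) q).comp (ContinuousLinearMap.inr ℝ ℝ ℂ))
      q.2 := by
    have h2 : HasFDerivAt (fun r : ℂ => (q.1, r)) (ContinuousLinearMap.inr ℝ ℝ ℂ) q.2 :=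
      hasFDerivAt_prodMk_right q.1 q.2
    exact HasFDerivAt.comp (g := field D) q.2 h.hasFDerivAt h2
  simp only [gradAt, grad, gradient, h1.fderiv]

lemma inner_gradAt (h : DifferentiableAt ℝ (field D) q) (w : ℂ) :
    inner ℝ (gradAt D q) w = fderiv ℝ (field D) q (0, w) := by
  rw [gradAt_eq_toDual_symm h, InnerProductSpace.toDual_symm_apply]
  simp

lemma eventually_contDiffAt (h : ContDiffAt ℝ 2 (field D) q) :
    ∀ᶠ p in 𝓝 q, ContDiffAt ℝ 2 (field D) p := h.eventually (by simp)

lemma contDiffAt_fderiv (h : ContDiffAt ℝ 2 (field D) q) :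
    ContDiffAt ℝ 1 (fderiv ℝ (field D)) q := h.fderiv_right (by norm_num)

lemma differentiableAt_field (h : ContDiffAt ℝ 2 (field D) q) :
    DifferentiableAt ℝ (field D) q := h.differentiableAt (by norm_num)

lemma contDiffAt_gradAt (h : ContDiffAt ℝ 2 (field D) q) : ContDiffAt ℝ 1 (gradAt D) q := by
  have h1 : gradAt D =ᶠ[𝓝 q] fun p => (InnerProductSpace.toDual ℝ ℂ).symm
      ((fderiv ℝ (field D) p).comp (ContinuousLinearMap.inr ℝ ℝ ℂ)) := by
    filter_upwards [eventually_contDiffAt h] with p hp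
    exact gradAt_eq_toDual_symm (differentiableAt_field hp)
  refine ContDiffAt.congr_of_eventuallyEq ?_ h1
  exact (InnerProductSpace.toDual ℝ ℂ).symm.toContinuousLinearEquiv.contDiff.contDiffAt.comp q
    ((contDiffAt_fderiv h).clm_comp contDiffAt_const)

lemma hasFDerivAt_gradAt (h : ContDiffAt ℝ 2 (field D) q) :
    HasFDerivAt (gradAt D) (fderiv ℝ (gradAt D) q) q :=
  ((contDiffAt_gradAt h).differentiableAt (by norm_num)).hasFDerivAt

lemma hasFDerivAt_fderiv (h : ContDiffAt ℝ 2 (field D) q) :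
    HasFDerivAt (fderiv ℝ (field D)) (fderiv ℝ (fderiv ℝ (field D)) q) q :=
  ((contDiffAt_fderiv h).differentiableAt (by norm_num)).hasFDerivAt

/-- Differentiates the identity of `inner_gradAt`, which holds on a whole neighbourhood. All
second-order characteristics are thereby reduced to one symmetric bilinear form on space-time. -/
lemma inner_fderiv_gradAt (h : ContDiffAt ℝ 2 (field D) q) (x : ℝ × ℂ) (w : ℂ) :
    inner ℝ (fderiv ℝ (gradAt D) q x) w = hess D q x (0, w) := by
  have h1 : (fun p => inner ℝ (gradAt D p) w) =ᶠ[𝓝 q] fun p => fderiv ℝ (field D) p (0, w) := by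
    filter_upwards [eventually_contDiffAt h] with p hp
    exact inner_gradAt (differentiableAt_field hp) w
  have h2 := (hasFDerivAt_gradAt h).inner ℝ (hasFDerivAt_const w q)
  have h3 := ((hasFDerivAt_fderiv h).clm_apply (hasFDerivAt_const ((0 : ℝ), w) q))
  have h4 := congrArg (fun l => l x) (h2.unique (h3.congr_of_eventuallyEq h1))
  simpa [hess] using h4

lemma hess_symm (h : ContDiffAt ℝ 2 (field D) q) (x y : ℝ × ℂ) : hess D q x y = hess D q y x :=
  (h.isSymmSndFDerivAt (by simp)) x y

lemma Regular.eventually (h : Regular D q) : ∀ᶠ p in 𝓝 q, Regular D p := by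
  filter_upwards [eventually_contDiffAt h.1,
    (contDiffAt_gradAt h.1).continuousAt.eventually_ne h.2] with p h1 h2 using ⟨h1, h2⟩

lemma Regular.norm_pos (h : Regular D q) : 0 < ‖gradAt D q‖ := norm_pos_iff.2 h.2

lemma Regular.hasFDerivAt_norm (h : Regular D q) :
    ∃ l : ℝ × ℂ →L[ℝ] ℝ, HasFDerivAt (fun p => ‖gradAt D p‖) l q ∧
      ∀ x, l x = hess D q x (0, normal D q.1 q.2) := by
  have h1 := (hasFDerivAt_gradAt h.1).norm_sq.sqrt (by simpa using h.2)
  simp only [Real.sqrt_sq (norm_nonneg _)] at h1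
  refine ⟨_, h1, fun x => ?_⟩
  have h2 : normal D q.1 q.2 = (‖gradAt D q‖)⁻¹ • gradAt D q := by
    simp [normal, gradAt]
  rw [← inner_fderiv_gradAt h.1, h2, inner_smul_right]
  have := h.norm_pos
  simp [real_inner_comm]
  field_simp

lemma normal_norm (h : Regular D q) : ‖normal D q.1 q.2‖ = 1 := by
  have := h.norm_pos
  unfold gradAt at this
  simp [normal]
  field_simp

lemma gradAt_eq_mul_normal (h : Regular D q) : gradAt D q = ‖gradAt D q‖ * normal D q.1 q.2 := by
  have := h.norm_pos
  unfold gradAt at *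
  simp only [normal]
  rw [← mul_assoc, mul_inv_cancel₀ (by exact_mod_cast this.ne'), one_mul]

lemma fderiv_field_normal (h : Regular D q) :
    fderiv ℝ (field D) q (0, normal D q.1 q.2) = ‖gradAt D q‖ := by
  rw [← inner_gradAt (differentiableAt_field h.1)]
  nth_rewrite 1 [gradAt_eq_mul_normal h]
  rw [← Complex.real_smul, inner_smul_left, real_inner_self_eq_norm_sq, normal_norm h]
  simp

lemma tendsto_div_of_hasDerivAt {f : ℝ → ℝ} {a : ℝ} (hf : HasDerivAt f a 0) (h0 : f 0 = 0) :
    Tendsto (fun h => f h / h) (𝓝[≠] 0) (𝓝 a) := by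
  have := hf.tendsto_slope
  refine this.congr fun h => ?_
  simp [slope_def_field, h0]

/-- The ordinate of the displaced isoline is, near a regular point, a differentiable function of
the parameter of the displacement. -/
lemma ordinate_hasDerivAt (hR : Regular D (t, r)) (a b : ℝ) :
    HasDerivAt (fun h : ℝ => ordinate D t r (t + a * h) (D t r + b * h))
      ((b - a * fderiv ℝ (field D) (t, r) (1, 0)) / ‖gradAt D (t, r)‖) 0 ∧
    ordinate D t r t (D t r) = 0 := by
  set N := normal D t r with hN
  set ρ := ‖gradAt D (t, r)‖ with hρ
  have hρ0 : 0 < ρ := hR.norm_pos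
  -- The parameters `a`, `b` let one implicit function serve both ordinates: `a = 1`, `b = 0` shifts
  -- the time, `a = 0`, `b = 1` shifts the level.
  set L : ℝ × ℝ →L[ℝ] ℝ × ℂ :=
    ((a • ContinuousLinearMap.fst ℝ ℝ ℝ).prod ((ContinuousLinearMap.snd ℝ ℝ ℝ).smulRight N))
    with hL
  set Φ : ℝ × ℝ → ℝ := fun w => field D ((t, r) + L w) - b * w.1 with hΦ
  have hs : HasStrictFDerivAt (field D) (fderiv ℝ (field D) (t, r)) ((t, r) + L 0) := by
    rw [map_zero, add_zero]
    exact hR.1.hasStrictFDerivAt (by norm_num)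
  have hd : HasStrictFDerivAt Φ ((fderiv ℝ (field D) (t, r)).comp L
      - b • ContinuousLinearMap.fst ℝ ℝ ℝ) 0 := by
    have h1 : HasStrictFDerivAt (fun w => (t, r) + L w) L 0 := L.hasStrictFDerivAt.const_add _
    refine (HasStrictFDerivAt.comp 0 hs h1).sub ?_
    exact (b • ContinuousLinearMap.fst ℝ ℝ ℝ).hasStrictFDerivAt
  set Φ' := (fderiv ℝ (field D) (t, r)).comp L - b • ContinuousLinearMap.fst ℝ ℝ ℝ with hΦ'
  have e2 : Φ' ∘L .inr ℝ ℝ ℝ = ContinuousLinearMap.toSpanSingleton ℝ ρ := by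
    ext
    have : L (0, 1) = (0, N) := by simp [hL]
    simpa [hΦ', this] using fderiv_field_normal hR
  have e1 : Φ' (1, 0) = a * fderiv ℝ (field D) (t, r) (1, 0) - b := by
    have : L (1, 0) = a • (1, 0) := by simp [hL]
    rw [hΦ', sub_apply, ContinuousLinearMap.comp_apply, this, map_smul]
    simp
  have hinv : (Φ' ∘L .inr ℝ ℝ ℝ).IsInvertible := by
    rw [e2]
    refine ⟨ContinuousLinearEquiv.unitsEquivAut ℝ (Units.mk0 ρ hρ0.ne'), ?_⟩
    ext; simp
  set ψ := hd.implicitFunctionOfProdDomain hinv with hψ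
  have hev := hd.eventually_apply_eq_iff_implicitFunctionOfProdDomain hinv
  have hder := (hd.hasStrictFDerivAt_implicitFunctionOfProdDomain hinv).hasFDerivAt.hasDerivAt
  have hψ0 : ψ 0 = 0 := hev.self_of_nhds.mp rfl
  have hval : ∀ h p : ℝ, Φ (h, p) = D (t + a * h) (r + p * N) - b * h := by
    intro h p; simp [hΦ, field, hL]
  have hΦ0 : Φ 0 = D t r := by simp [hΦ, field]
  have hord : ∀ᶠ h in 𝓝 (0 : ℝ),
      ordinate D t r (t + a * h) (D t r + b * h) = ψ h := by
    rw [← hψ, hΦ0] at hev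
    obtain ⟨ε, hε, hball⟩ := Metric.eventually_nhds_iff.1 hev
    have hψc : Tendsto ψ (𝓝 0) (𝓝 0) := by
      have := hder.continuousAt.tendsto
      rwa [show (0 : ℝ × ℝ).1 = 0 from rfl, ← hψ, hψ0] at this
    filter_upwards [Metric.tendsto_nhds.1 hψc ε hε, Metric.ball_mem_nhds 0 hε] with h h1 h2
    have key : ∀ p : ℝ, |p| < ε → (D (t + a * h) (r + p * N) = D t r + b * h ↔ ψ h = p) := by
      intro p hp
      have h3 := @hball (h, p) (by
        rw [Prod.dist_eq]; simpa [Real.dist_eq] using ⟨by simpa using h2, hp⟩)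
      rw [hval] at h3
      rw [← h3]; constructor <;> intro h <;> linarith
    have h1' : |ψ h| < ε := by simpa using h1
    have hex : ∃ p : ℝ, D (t + a * h) (r + p * N) = D t r + b * h ∧
        ∀ q : ℝ, D (t + a * h) (r + q * N) = D t r + b * h → |p| ≤ |q| := by
      -- The implicit function gives uniqueness only for `|p| < ε`. A root closer to zero than `ψ h`
      -- would lie in that range, so `ψ h` is the nearest root globally.
      refine ⟨ψ h, (key _ h1').2 rfl, fun q hq => ?_⟩
      by_contra hlt
      push Not at hlt
      have := (key q (hlt.trans h1')).1 hq
      rw [this] at hlt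
      exact lt_irrefl _ hlt
    have hsp := Classical.epsilon_spec hex
    have hle := hsp.2 (ψ h) ((key _ h1').2 rfl)
    exact ((key _ (hle.trans_lt h1')).1 hsp.1).symm
  refine ⟨?_, ?_⟩
  · have hder' : HasDerivAt ψ ((b - a * fderiv ℝ (field D) (t, r) (1, 0)) / ρ) 0 := by
      refine HasDerivAt.congr_deriv hder ?_
      have h3 : (Φ' ∘L .inr ℝ ℝ ℝ).inverse (Φ' (1, 0)) = Φ' (1, 0) / ρ := by
        have h4 : Φ' (1, 0) = (Φ' ∘L .inr ℝ ℝ ℝ) (Φ' (1, 0) / ρ) := by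
          rw [e2]; simp; field_simp
        nth_rewrite 1 [h4]
        rw [← ContinuousLinearMap.comp_apply, hinv.inverse_comp_self]
        rfl
      change -(Φ' ∘L .inr ℝ ℝ ℝ).inverse (Φ' (1, 0)) = _
      rw [h3, e1]; ring
    exact hder'.congr_of_eventuallyEq hord
  · have := hord.self_of_nhds
    simpa [hψ0] using this

lemma displacement_hasDerivAt (hR : Regular D (t, r)) :
    HasDerivAt (displacement D t r)
      (-fderiv ℝ (field D) (t, r) (1, 0) / ‖gradAt D (t, r)‖) 0 := by
  have h := (ordinate_hasDerivAt hR 1 0).1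
  simp only [one_mul, zero_mul, add_zero, zero_sub] at h
  exact h

lemma displacement_zero (hR : Regular D (t, r)) : displacement D t r 0 = 0 := by
  simpa [displacement] using (ordinate_hasDerivAt hR 0 0).2

lemma frontVelocity_eq (hR : Regular D (t, r)) :
    frontVelocity D t r = -fderiv ℝ (field D) (t, r) (1, 0) / ‖gradAt D (t, r)‖ :=
  (tendsto_div_of_hasDerivAt (displacement_hasDerivAt hR) (displacement_zero hR)).limUnder_eq

lemma density_eq (hR : Regular D (t, r)) : density D t r = ‖gradAt D (t, r)‖ := by
  have h1 := (ordinate_hasDerivAt hR 0 1).1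
  have h0 := (ordinate_hasDerivAt hR 0 0).2
  simp only [zero_mul, add_zero, one_mul, sub_zero, one_div] at h1
  have h2 := tendsto_div_of_hasDerivAt h1 (by simpa using h0)
  have h3 := h2.inv₀ (inv_ne_zero hR.norm_pos.ne')
  rw [inv_inv] at h3
  exact (h3.congr fun h => by simp).limUnder_eq

lemma frontPoint_hasDerivAt (hR : Regular D (t, r)) :
    HasDerivAt (fun h : ℝ => (t + h, frontPoint D t r h))
      ((1 : ℝ), (frontVelocity D t r : ℂ) * normal D t r) 0 := by
  have h1 := (displacement_hasDerivAt hR).ofReal_comp.mul_const (normal D t r)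
  rw [← frontVelocity_eq hR] at h1
  exact ((hasDerivAt_id 0).const_add t).prodMk (h1.const_add r)

lemma frontPoint_zero (hR : Regular D (t, r)) : frontPoint D t r 0 = r := by
  simp [frontPoint, displacement_zero hR]

end Characteristics

/-! ### Second-order characteristics through the space-time Hessian -/

section SecondOrder

variable {D : ℝ → ℂ → ℝ} {q : ℝ × ℂ} {t : ℝ} {r : ℂ}

lemma eq_frame_sum {N : ℂ} (hN : ‖N‖ = 1) (w : ℂ) :
    w = (inner ℝ w N : ℝ) * N + (inner ℝ w (-Complex.I * N) : ℝ) * (-Complex.I * N) := by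
  have h : N.re * N.re + N.im * N.im = 1 := by
    rw [← Complex.normSq_apply, Complex.normSq_eq_norm_sq, hN]; norm_num
  apply Complex.ext
  · simp [Complex.inner]
    linear_combination -w.re * h
  · simp [Complex.inner]
    linear_combination -w.im * h

/-- The chain rule for a characteristic `g` known to agree with a differentiable formula `G` only
near `q`; it turns each defining limit into a directional derivative. -/
lemma tendsto_slope_comp {g G : ℝ × ℂ → ℝ} {l : ℝ × ℂ →L[ℝ] ℝ} {c : ℝ → ℝ × ℂ} {x : ℝ × ℂ}
    (hG : HasFDerivAt G l q) (hg : g =ᶠ[𝓝 q] G) (hc : HasDerivAt c x 0) (h0 : c 0 = q) :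
    Tendsto (fun h => (g (c h) - g q) / h) (𝓝[≠] 0) (𝓝 (l x)) := by
  subst h0
  have h1 := ((hG.congr_of_eventuallyEq hg).comp_hasDerivAt 0 hc).tendsto_slope
  refine h1.congr fun h => ?_
  simp [slope_def_field]

lemma Regular.hasFDerivAt_frontVelocity (hR : Regular D q) :
    ∃ l : ℝ × ℂ →L[ℝ] ℝ, HasFDerivAt (fun p => -fderiv ℝ (field D) p (1, 0) / ‖gradAt D p‖) l q ∧
      ∀ x, l x = -hess D q x (1, 0) / ‖gradAt D q‖
        - (-fderiv ℝ (field D) q (1, 0) / ‖gradAt D q‖) *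
          (hess D q x (0, normal D q.1 q.2) / ‖gradAt D q‖) := by
  obtain ⟨l, hl, hlx⟩ := hR.hasFDerivAt_norm
  have h1 := ((hasFDerivAt_fderiv hR.1).clm_apply (hasFDerivAt_const ((1 : ℝ), (0 : ℂ)) q)).neg
  have h2 := (hasDerivAt_inv hR.norm_pos.ne').comp_hasFDerivAt q hl
  refine ⟨_, h1.mul h2, fun x => ?_⟩
  have := hR.norm_pos
  simp [hlx, hess]
  field_simp
  ring

lemma eventually_frontVelocity_eq (hR : Regular D q) :
    (fun p : ℝ × ℂ => frontVelocity D p.1 p.2) =ᶠ[𝓝 q]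
      fun p => -fderiv ℝ (field D) p (1, 0) / ‖gradAt D p‖ := by
  filter_upwards [hR.eventually] with p hp using frontVelocity_eq hp

lemma eventually_density_eq (hR : Regular D q) :
    (fun p : ℝ × ℂ => density D p.1 p.2) =ᶠ[𝓝 q] fun p => ‖gradAt D p‖ := by
  filter_upwards [hR.eventually] with p hp using density_eq hp

/-- The space-time velocity of the point of the isoline that moves along the normal. -/
def frontDir (D : ℝ → ℂ → ℝ) (t : ℝ) (r : ℂ) : ℝ × ℂ :=
  (1, (frontVelocity D t r : ℂ) * normal D t r)

lemma frontAcceleration_eq (hR : Regular D (t, r)) :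
    frontAcceleration D t r = -hess D (t, r) (frontDir D t r) (1, 0) / ‖gradAt D (t, r)‖
      - frontVelocity D t r *
        (hess D (t, r) (frontDir D t r) (0, normal D t r) / ‖gradAt D (t, r)‖) := by
  obtain ⟨l, hl, hlx⟩ := hR.hasFDerivAt_frontVelocity
  have h := tendsto_slope_comp hl (eventually_frontVelocity_eq hR) (frontPoint_hasDerivAt hR)
    (by simp [frontPoint_zero hR])
  rw [frontAcceleration, h.limUnder_eq, hlx, frontVelocity_eq hR, frontDir, frontVelocity_eq hR]

lemma densityRate_eq (hR : Regular D (t, r)) :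
    densityRate D t r =
      hess D (t, r) (frontDir D t r) (0, normal D t r) / ‖gradAt D (t, r)‖ := by
  obtain ⟨l, hl, hlx⟩ := hR.hasFDerivAt_norm
  have h := tendsto_slope_comp hl (eventually_density_eq hR) (frontPoint_hasDerivAt hR)
    (by simp [frontPoint_zero hR])
  rw [densityRate, h.limUnder_eq, hlx, density_eq hR, frontDir, div_eq_inv_mul]

lemma hasDerivAt_line (t : ℝ) (r w : ℂ) :
    HasDerivAt (fun s : ℝ => (t, r + s * w)) ((0 : ℝ), w) 0 := by
  have h : HasDerivAt (fun s : ℝ => r + s * w) w 0 := by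
    simpa using ((hasDerivAt_id (0 : ℝ)).ofReal_comp.mul_const w).const_add r
  exact (hasDerivAt_const 0 t).prodMk h

lemma tangentialRate_eq (hR : Regular D (t, r)) :
    tangentialRate D t r =
      hess D (t, r) (0, tangent D t r) (0, normal D t r) / ‖gradAt D (t, r)‖ := by
  obtain ⟨l, hl, hlx⟩ := hR.hasFDerivAt_norm
  have h := tendsto_slope_comp hl (eventually_density_eq hR)
    (hasDerivAt_line t r (tangent D t r)) (by simp)
  rw [tangentialRate, h.limUnder_eq, hlx, density_eq hR, div_eq_inv_mul]

lemma normalRate_eq (hR : Regular D (t, r)) :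
    normalRate D t r =
      hess D (t, r) (0, normal D t r) (0, normal D t r) / ‖gradAt D (t, r)‖ := by
  obtain ⟨l, hl, hlx⟩ := hR.hasFDerivAt_norm
  have h := tendsto_slope_comp hl (eventually_density_eq hR)
    (hasDerivAt_line t r (normal D t r)) (by simp)
  rw [normalRate, h.limUnder_eq, hlx, density_eq hR, div_eq_inv_mul]

/-- A unit vector can only rotate: the component of the change of the gradient along `N` is
cancelled by that of the norm, and only the component along `T` survives. Curvature and angular
velocity are its instances along `T` and along the front. -/
lemma hasDerivAt_tangent {c : ℝ → ℝ × ℂ} {x : ℝ × ℂ} (hR : Regular D q)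
    (hc : HasDerivAt c x 0) (h0 : c 0 = q) :
    HasDerivAt (fun h => tangent D (c h).1 (c h).2)
      (-((hess D q x (0, tangent D q.1 q.2) / ‖gradAt D q‖ : ℝ) : ℂ) * normal D q.1 q.2) 0 := by
  subst h0
  obtain ⟨l, hl, hlx⟩ := hR.hasFDerivAt_norm
  have hρ : (‖gradAt D (c 0)‖ : ℂ) ≠ 0 := by exact_mod_cast hR.norm_pos.ne'
  have h1 := ((hl.comp_hasDerivAt 0 hc).inv hR.norm_pos.ne').ofReal_comp
  have h2 := (hasFDerivAt_gradAt hR.1).comp_hasDerivAt 0 hc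
  have h3 := (h1.mul h2).const_mul (-Complex.I)
  have h4 := eq_frame_sum (normal_norm hR) (fderiv ℝ (gradAt D) (c 0) x)
  rw [inner_fderiv_gradAt hR.1, inner_fderiv_gradAt hR.1] at h4
  refine HasDerivAt.congr_deriv (f' := _) (h3.congr_of_eventuallyEq ?_) ?_
  · refine Eventually.of_forall fun h => ?_
    simp [tangent, normal, gradAt]
  · simp only [Pi.inv_apply, Function.comp_apply, hlx, h4, tangent]
    rw [gradAt_eq_mul_normal hR]
    simp only [norm_mul, Complex.norm_real, norm_norm, normal_norm hR, mul_one]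
    push_cast
    field_simp
    ring_nf
    simp only [Complex.I_sq]
    ring

lemma inner_real_mul_left (a : ℝ) (z w : ℂ) : inner ℝ ((a : ℂ) * z) w = a * inner ℝ z w := by
  rw [← Complex.real_smul, real_inner_smul_left]

lemma curvature_eq (hR : Regular D (t, r)) :
    curvature D t r =
      -(hess D (t, r) (0, tangent D t r) (0, tangent D t r) / ‖gradAt D (t, r)‖) := by
  have h := hasDerivAt_tangent hR (hasDerivAt_line t r (tangent D t r)) (by simp)
  have h' := h.deriv
  simp only at h'
  rw [curvature, h', ← Complex.ofReal_neg, inner_real_mul_left, real_inner_self_eq_norm_sq,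
    normal_norm hR]
  simp

lemma angularVelocity_eq (hR : Regular D (t, r)) :
    angularVelocity D t r =
      -(hess D (t, r) (frontDir D t r) (0, tangent D t r) / ‖gradAt D (t, r)‖) := by
  have h := hasDerivAt_tangent hR (frontPoint_hasDerivAt hR) (by simp [frontPoint_zero hR])
  have hN : normal D t r ≠ 0 := by
    have := normal_norm hR
    intro h
    simp [h] at this
  have hT : tangent D t r ≠ 0 := by simp [tangent, hN]
  have h1 := h.div_const (tangent D t r)
  have e0 : tangent D (t + 0) (frontPoint D t r 0) / tangent D t r = 1 := by
    simp [frontPoint_zero hR, hT]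
  -- The argument is the imaginary part of the logarithm, which is smooth near the value `1` of the
  -- quotient at `h = 0`.
  have h2 := h1.clog_real (by simp only [e0]; simp)
  have h3 := Complex.imCLM.hasFDerivAt.comp_hasDerivAt 0 h2
  have h4 := tendsto_div_of_hasDerivAt h3 (by simp [frontPoint_zero hR, hT])
  refine (h4.congr fun h => ?_).limUnder_eq.trans ?_
  · simp [Complex.log_im]
  · have e1 : normal D t r / tangent D t r = Complex.I := by
      rw [tangent]
      field_simp
      simp
    simp only [e0, div_one, mul_div_assoc, e1]
    rw [← Complex.ofReal_neg]
    simp [frontDir]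

end SecondOrder

/-! ### Derivatives of the reading in the Frenet frame and the gain estimate -/

section Gains

variable {D : ℝ → ℂ → ℝ} {q : ℝ × ℂ} {t : ℝ} {r : ℂ}

/-- The rate of the field reading of a vehicle with the heading `θ`. -/
def flow (D : ℝ → ℂ → ℝ) (v : ℝ) (q : ℝ × ℂ) (θ : ℝ) : ℝ :=
  fderiv ℝ (field D) q (1, v * dir θ)

/-- The part of the second derivative of the field reading that does not depend on the turning
rate. -/
def drift (D : ℝ → ℂ → ℝ) (v : ℝ) (q : ℝ × ℂ) (θ : ℝ) : ℝ :=
  hess D q (1, v * dir θ) (1, v * dir θ)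

/-- The factor of the turning rate in the second derivative of the field reading. -/
def steer (D : ℝ → ℂ → ℝ) (v : ℝ) (q : ℝ × ℂ) (θ : ℝ) : ℝ :=
  fderiv ℝ (field D) q (0, v * (Complex.I * dir θ))

/-- The switching quantity as a function of the state. -/
def switch (D : ℝ → ℂ → ℝ) (v γ δ d₀ : ℝ) (q : ℝ × ℂ) (θ : ℝ) : ℝ :=
  flow D v q θ + chi γ δ (field D q - d₀)

lemma norm_dir (θ : ℝ) : ‖dir θ‖ = 1 := Complex.norm_exp_ofReal_mul_I θ

/-- Splits the motion into riding on the isoline, crossing it, and travelling along it, the three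
directions in which the characteristics are defined. -/
lemma velocity_eq (hR : Regular D (t, r)) (v θ : ℝ) :
    ((1 : ℝ), (v : ℂ) * dir θ) = frontDir D t r
      + (v * inner ℝ (dir θ) (normal D t r) - frontVelocity D t r) • ((0 : ℝ), normal D t r)
      + (v * inner ℝ (dir θ) (tangent D t r)) • ((0 : ℝ), tangent D t r) := by
  have h := eq_frame_sum (normal_norm hR) (dir θ)
  refine Prod.ext (by simp [frontDir]) ?_
  simp only [frontDir, Prod.snd_add, Prod.smul_snd, Complex.real_smul]
  nth_rewrite 1 [h]
  simp only [tangent]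
  push_cast
  ring

lemma fderiv_field_tangent (hR : Regular D (t, r)) :
    fderiv ℝ (field D) (t, r) (0, tangent D t r) = 0 := by
  rw [← inner_gradAt (differentiableAt_field hR.1), gradAt_eq_mul_normal hR, inner_real_mul_left]
  simp only [tangent, Complex.inner]
  simp
  right; ring

lemma fderiv_field_frontDir (hR : Regular D (t, r)) :
    fderiv ℝ (field D) (t, r) (frontDir D t r) = 0 := by
  have h : frontDir D t r = (1, 0) + frontVelocity D t r • ((0 : ℝ), normal D t r) := by
    simp [frontDir]
  have h1 := fderiv_field_normal hR
  simp only at h1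
  have := hR.norm_pos
  rw [h, map_add, map_smul, h1, frontVelocity_eq hR]
  simp
  field_simp
  ring

lemma flow_eq (hR : Regular D (t, r)) (v θ : ℝ) :
    flow D v (t, r) θ = ‖gradAt D (t, r)‖ *
      (v * inner ℝ (dir θ) (normal D t r) - frontVelocity D t r) := by
  have h1 := fderiv_field_normal hR
  simp only at h1
  rw [flow, velocity_eq hR, map_add, map_add, map_smul, map_smul, fderiv_field_frontDir hR,
    fderiv_field_tangent hR, h1]
  simp
  ring

lemma steer_eq (hR : Regular D (t, r)) (v θ : ℝ) :
    steer D v (t, r) θ = ‖gradAt D (t, r)‖ * (v * inner ℝ (dir θ) (tangent D t r)) := by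
  rw [steer, ← inner_gradAt (differentiableAt_field hR.1), gradAt_eq_mul_normal hR,
    inner_real_mul_left]
  simp only [tangent, Complex.inner]
  simp [normal_norm hR]
  left; ring

/-- The Hessian is expanded over the decomposition `velocity_eq`; its symmetry merges the mixed
terms, whence the factors 2. -/
lemma drift_eq (hR : Regular D (t, r)) (v θ : ℝ) {z C : ℝ}
    (hz : z = v * inner ℝ (dir θ) (normal D t r) - frontVelocity D t r)
    (hC : C = v * inner ℝ (dir θ) (tangent D t r)) :
    drift D v (t, r) θ = ‖gradAt D (t, r)‖ *
      (-frontAcceleration D t r + 2 * densityRate D t r * z + normalRate D t r * z ^ 2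
        - 2 * C * angularVelocity D t r + 2 * tangentialRate D t r * C * z
        - C ^ 2 * curvature D t r) := by
  have h0 : frontDir D t r = (1, 0) + frontVelocity D t r • ((0 : ℝ), normal D t r) := by
    simp [frontDir]
  have hadd : ∀ x y w, hess D (t, r) w (x + y) = hess D (t, r) w x + hess D (t, r) w y :=
    fun x y w => by simp only [hess, map_add]
  have hsmul : ∀ (a : ℝ) x w, hess D (t, r) w (a • x) = a * hess D (t, r) w x :=
    fun a x w => by simp only [hess, map_smul, smul_eq_mul]
  have hs := hess_symm hR.1
  have hXX : hess D (t, r) (frontDir D t r) (frontDir D t r) =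
      hess D (t, r) (frontDir D t r) (1, 0) +
        frontVelocity D t r * hess D (t, r) (frontDir D t r) (0, normal D t r) := by
    nth_rewrite 2 [h0]
    rw [hadd, hsmul]
  have hρ := hR.norm_pos
  rw [drift, velocity_eq hR, ← hz, ← hC, frontAcceleration_eq hR, densityRate_eq hR,
    normalRate_eq hR, angularVelocity_eq hR, tangentialRate_eq hR, curvature_eq hR]
  rw [hadd, hadd, hsmul, hsmul,
    hs (_ + _) (frontDir D t r), hs (_ + _) (0, normal D t r), hs (_ + _) (0, tangent D t r)]
  simp only [hadd, hsmul]
  rw [hXX, hs (0, normal D t r) (frontDir D t r), hs (0, tangent D t r) (frontDir D t r),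
    hs (0, normal D t r) (0, tangent D t r)]
  field_simp
  ring

lemma inner_sq_add_inner_sq (hR : Regular D (t, r)) (θ : ℝ) :
    inner ℝ (dir θ) (normal D t r) ^ 2 + inner ℝ (dir θ) (tangent D t r) ^ 2 = (1 : ℝ) := by
  have h1 : (normal D t r).re ^ 2 + (normal D t r).im ^ 2 = 1 := by
    have := normal_norm hR
    rw [Complex.norm_def, Real.sqrt_eq_one, Complex.normSq_apply] at this
    simpa [sq] using this
  have h2 : (dir θ).re ^ 2 + (dir θ).im ^ 2 = 1 := by
    have := norm_dir θ
    rw [Complex.norm_def, Real.sqrt_eq_one, Complex.normSq_apply] at this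
    linarith [this, sq (dir θ).re, sq (dir θ).im]
  simp only [tangent, Complex.inner]
  simp
  linear_combination h1 * ((dir θ).re ^ 2 + (dir θ).im ^ 2) + h2

/-- For `z = 0` the claim divided by `|C| = √(v² - λ²)` is the turning condition. For `|z| ≤ μ` both
`K = |C|` and `A = √(v² - λ²)` are at least `σ` and differ by at most `vμ/σ`. Replacing `A` by `K`
and adding the terms with `z` costs `O(μ)`, which the margin `Δu` covers. -/
lemma gain_inequality {lam z C α ω κ τ n w v Δlam Δu ubar μ σ γ bτ bn bκ bv bα : ℝ}
    (hv : 0 < v) (hΔ : 0 < Δlam) (hγ : 0 < γ) (hμ : 0 < μ)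
    (hσ2 : σ ^ 2 = Δlam ^ 2 - 2 * v * μ - μ ^ 2) (hσ : 0 < σ)
    (hC : C ^ 2 + (lam + z) ^ 2 = v ^ 2) (hz : |z| ≤ μ) (hlam : |lam| ≤ v - Δlam)
    (hturn : ∀ ε ∈ ({1, -1} : Set ℝ),
      |ε * (2 * ω) + α / √(v ^ 2 - lam ^ 2) + κ * √(v ^ 2 - lam ^ 2)| ≤ ubar - Δu)
    (hτ : |τ| ≤ bτ) (hn : |n| ≤ bn) (hκ : |κ| ≤ bκ) (hw : |w| ≤ bv) (hα : |α| ≤ bα)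
    (hgain : (3 * bτ + (v * bκ + 2 * bv + γ + bn * μ) / σ + v * bα / σ ^ 3) * μ < Δu) :
    |-α + 2 * w * z + n * z ^ 2 - 2 * C * ω + 2 * τ * C * z - C ^ 2 * κ| + γ * |z|
      < ubar * |C| := by
  have hbτ := (abs_nonneg _).trans hτ
  have hbn := (abs_nonneg _).trans hn
  have hbκ := (abs_nonneg _).trans hκ
  have hbv := (abs_nonneg _).trans hw
  have hbα := (abs_nonneg _).trans hα
  have hlam0 := abs_nonneg lam
  have hz0 := abs_nonneg z
  have hvlam : σ ^ 2 ≤ v ^ 2 - lam ^ 2 := by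
    rw [← sq_abs lam]
    nlinarith
  set A := √(v ^ 2 - lam ^ 2) with hA
  have hA2 : A ^ 2 = v ^ 2 - lam ^ 2 := Real.sq_sqrt (by nlinarith)
  have hσA : σ ≤ A := Real.le_sqrt_of_sq_le hvlam
  set K := |C| with hK
  have hK2 : K ^ 2 = v ^ 2 - (lam + z) ^ 2 := by rw [hK, sq_abs]; linarith
  have hlz : |lam * z| ≤ (v - Δlam) * μ := by
    rw [abs_mul]; gcongr; linarith
  have hzz : z ^ 2 ≤ μ ^ 2 := by rw [← sq_abs]; gcongr
  have hσK : σ ≤ K := by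
    refine abs_le_of_sq_le_sq' ?_ (abs_nonneg _) |>.2
    rw [hK2, hσ2]
    have h1 := (abs_le.1 hlz).2
    have h2 : lam ^ 2 ≤ (v - Δlam) ^ 2 := by rw [← sq_abs]; gcongr
    nlinarith [mul_pos hΔ hμ]
  have hK0 : 0 < K := hσ.trans_le hσK
  have hA0 : 0 < A := hσ.trans_le hσA
  have hKA : |K - A| ≤ v * μ / σ := by
    have h1 : |lam + z| ≤ v := abs_le_of_sq_le_sq (by nlinarith [sq_nonneg C]) hv.le
    have h2 : |K - A| * (K + A) = |z| * |lam + (lam + z)| := by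
      -- Difference of squares: `K² - A² = -z (2λ + z)`.
      rw [← abs_of_pos (add_pos hK0 hA0), ← abs_mul, ← abs_mul, ← abs_neg (z * _)]
      congr 1
      linear_combination hK2 - hA2
    have h3 : |lam + (lam + z)| ≤ 2 * v := (abs_add_le _ _).trans (by linarith)
    have h4 : |z| * |lam + (lam + z)| ≤ μ * (2 * v) := by gcongr
    rw [le_div_iff₀ hσ]
    have h5 : |K - A| * (2 * σ) ≤ |K - A| * (K + A) := by gcongr; linarith
    linarith
  have hinv : |α / K - α / A| ≤ v * bα / σ ^ 3 * μ := by
    have h1 : α / K - α / A = -α * (K - A) / (K * A) := by field_simp; ring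
    rw [h1, abs_div, abs_mul, abs_neg, abs_of_pos (mul_pos hK0 hA0)]
    calc |α| * |K - A| / (K * A) ≤ bα * (v * μ / σ) / (σ * σ) := by gcongr
      _ = _ := by field_simp
  have hcur : |κ * (K - A)| ≤ v * bκ / σ * μ := by
    rw [abs_mul]
    calc |κ| * |K - A| ≤ bκ * (v * μ / σ) := by gcongr
      _ = _ := by field_simp
  -- The sense of travel along the isoline selects which of the two sign variants of the turning
  -- condition applies.
  obtain ⟨ε, hε, hCε⟩ : ∃ ε ∈ ({1, -1} : Set ℝ), C = ε * K := by
    rcases abs_cases C with h | h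
    · exact ⟨1, by simp, by rw [hK, h.1]; ring⟩
    · exact ⟨-1, by simp, by rw [hK, h.1]; ring⟩
  have hmain : |ε * (2 * ω) + α / K + κ * K|
      ≤ ubar - Δu + v * bα / σ ^ 3 * μ + v * bκ / σ * μ := by
    have h1 : ε * (2 * ω) + α / K + κ * K = (ε * (2 * ω) + α / A + κ * A)
        + (α / K - α / A) + κ * (K - A) := by ring
    rw [h1]
    refine (abs_add_le _ _).trans (add_le_add ((abs_add_le _ _).trans (add_le_add ?_ hinv)) hcur)
    exact hturn ε hε
  have hrest : |2 * w * z + n * z ^ 2| + γ * |z| ≤ (2 * bv + γ + bn * μ) * μ := by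
    have h1 : |2 * w * z| ≤ 2 * bv * μ := by
      rw [abs_mul, abs_mul, abs_two]; gcongr
    have h2 : |n * z ^ 2| ≤ bn * μ ^ 2 := by
      rw [abs_mul, abs_of_nonneg (sq_nonneg z)]; gcongr
    have h3 : γ * |z| ≤ γ * μ := by gcongr
    linarith [abs_add_le (2 * w * z) (n * z ^ 2)]
  have hrest' : (2 * bv + γ + bn * μ) * μ ≤ K * ((2 * bv + γ + bn * μ) / σ * μ) := by
    have h0 : 0 ≤ (2 * bv + γ + bn * μ) / σ * μ := by positivity
    calc (2 * bv + γ + bn * μ) * μ = σ * ((2 * bv + γ + bn * μ) / σ * μ) := by field_simp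
      _ ≤ _ := by gcongr
  have htau : |2 * τ * C * z| ≤ K * (2 * bτ * μ) := by
    rw [abs_mul, abs_mul, abs_mul, abs_two, ← hK]
    calc 2 * |τ| * K * |z| ≤ 2 * bτ * K * μ := by gcongr
      _ = _ := by ring
  have hsplit : -α + 2 * w * z + n * z ^ 2 - 2 * C * ω + 2 * τ * C * z - C ^ 2 * κ
      = -(K * (ε * (2 * ω) + α / K + κ * K)) + (2 * w * z + n * z ^ 2) + 2 * τ * C * z := by
    have : C ^ 2 = K ^ 2 := (sq_abs C).symm
    rw [this]
    nth_rewrite 1 [hCε]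
    field_simp
    ring
  have hmain' : |-(K * (ε * (2 * ω) + α / K + κ * K))| ≤
      K * (ubar - Δu + v * bα / σ ^ 3 * μ + v * bκ / σ * μ) := by
    rw [abs_neg, abs_mul, abs_of_pos hK0]; gcongr
  have htri : |-(K * (ε * (2 * ω) + α / K + κ * K)) + (2 * w * z + n * z ^ 2) + 2 * τ * C * z|
      ≤ |-(K * (ε * (2 * ω) + α / K + κ * K))| + |2 * w * z + n * z ^ 2| + |2 * τ * C * z| :=
    (abs_add_le _ _).trans (add_le_add (abs_add_le _ _) le_rfl)
  rw [hsplit]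
  have hfin : K * (ubar - Δu + v * bα / σ ^ 3 * μ + v * bκ / σ * μ
      + (2 * bv + γ + bn * μ) / σ * μ + 2 * bτ * μ) < ubar * K := by
    rw [mul_comm ubar]
    refine mul_lt_mul_of_pos_left ?_ hK0
    have h1 : (3 * bτ + (v * bκ + 2 * bv + γ + bn * μ) / σ + v * bα / σ ^ 3) * μ
        = bτ * μ + 2 * bτ * μ + v * bκ / σ * μ + (2 * bv + γ + bn * μ) / σ * μ
          + v * bα / σ ^ 3 * μ := by ring
    -- The estimate consumes only `2 bτ μ`; the third `bτ μ` in the gain condition is slack.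
    have h2 : 0 ≤ bτ * μ := by positivity
    linarith
  linarith

lemma abs_chi_le {γ δ : ℝ} (hγ : 0 < γ) (hδ : 0 < δ) (p : ℝ) : |chi γ δ p| ≤ γ * δ := by
  unfold chi
  split_ifs with h
  · rw [abs_mul, abs_of_pos hγ]; gcongr
  · rw [abs_mul, abs_of_pos (mul_pos hγ hδ)]
    have : |Real.sign p| ≤ 1 := by
      rcases Real.sign_apply_eq p with h | h | h <;> simp [h]
    nlinarith [mul_pos hγ hδ]

lemma chi_of_le {γ δ p : ℝ} (hδ : 0 < δ) (h : δ ≤ p) : chi γ δ p = γ * δ := by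
  unfold chi
  split_ifs with h1
  · rw [le_antisymm ((abs_le.1 h1).2) h]
  · rw [Real.sign_of_pos (hδ.trans_le h), one_mul]

lemma chi_of_le_neg {γ δ p : ℝ} (hδ : 0 < δ) (h : p ≤ -δ) : chi γ δ p = -(γ * δ) := by
  unfold chi
  split_ifs with h1
  · rw [le_antisymm h ((abs_le.1 h1).1)]; ring
  · rw [Real.sign_of_neg (by linarith)]; ring

lemma chi_eq_max_min {γ δ : ℝ} (hδ : 0 < δ) (p : ℝ) :
    chi γ δ p = γ * max (-δ) (min δ p) := by
  rcases le_total δ p with h | h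
  · rw [chi_of_le hδ h, min_eq_left h, max_eq_right (by linarith)]
  · rw [min_eq_right h]
    rcases le_total p (-δ) with h1 | h1
    · rw [chi_of_le_neg hδ h1, max_eq_left h1]; ring
    · rw [max_eq_right h1, chi, if_pos (abs_le.2 ⟨h1, h⟩)]

lemma continuous_chi {γ δ : ℝ} (hδ : 0 < δ) : Continuous (chi γ δ) := by
  have : chi γ δ = fun p => γ * max (-δ) (min δ p) := funext (chi_eq_max_min hδ)
  rw [this]
  fun_prop

/-- A monotone `γ`-Lipschitz function has chord slopes in `[0, γ]`. The slope `m` replaces the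
derivative of `χ`, which is missing at `±δ`. -/
lemma exists_chi_sub {γ δ : ℝ} (hγ : 0 < γ) (hδ : 0 < δ) (a b : ℝ) :
    ∃ m, 0 ≤ m ∧ m ≤ γ ∧ chi γ δ b - chi γ δ a = m * (b - a) := by
  rcases eq_or_ne a b with rfl | hab
  · exact ⟨0, le_rfl, hγ.le, by simp⟩
  · wlog h : a < b generalizing a b
    · obtain ⟨m, h1, h2, h3⟩ := this b a hab.symm (lt_of_le_of_ne (not_lt.1 h) hab.symm)
      exact ⟨m, h1, h2, by linarith⟩
    have h0 : 0 < b - a := sub_pos.2 h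
    have h1 : max (-δ) (min δ a) ≤ max (-δ) (min δ b) := by gcongr
    have h2 : max (-δ) (min δ b) - max (-δ) (min δ a) ≤ b - a := by
      rcases max_cases (-δ) (min δ b) with h3 | h3 <;> rcases min_cases δ b with h4 | h4 <;>
      rcases max_cases (-δ) (min δ a) with h5 | h5 <;> rcases min_cases δ a with h6 | h6 <;>
      linarith
    refine ⟨(chi γ δ b - chi γ δ a) / (b - a), ?_, ?_, by field_simp⟩
    · rw [chi_eq_max_min hδ, chi_eq_max_min hδ]
      exact div_nonneg (by nlinarith) h0.le
    · rw [chi_eq_max_min hδ, chi_eq_max_min hδ, div_le_iff₀ h0]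
      nlinarith

end Gains

/-! ### Dynamics of the switching quantity and attraction to its zero set -/

section Dynamics

variable {D : ℝ → ℂ → ℝ} {q : ℝ × ℂ} {t : ℝ} {r : ℝ → ℂ} {θ u : ℝ → ℝ} {J : Set ℝ}
  {v γ δ d₀ ubar dlo dhi : ℝ}

lemma continuous_dir : Continuous dir := by unfold dir; fun_prop

lemma hasDerivAt_dir (φ : ℝ) : HasDerivAt dir (Complex.I * dir φ) φ := by
  have h := ((hasDerivAt_id φ).ofReal_comp.mul_const Complex.I).cexp
  refine HasDerivAt.congr_deriv h ?_
  simp [dir, mul_comm]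

lemma continuousAt_fderiv_field (h : ContDiffAt ℝ 2 (field D) q) :
    ContinuousAt (fderiv ℝ (field D)) q := (contDiffAt_fderiv h).continuousAt

lemma continuousAt_fderiv_fderiv_field (h : ContDiffAt ℝ 2 (field D) q) :
    ContinuousAt (fderiv ℝ (fderiv ℝ (field D))) q :=
  (ContDiffAt.fderiv_right (m := 0) (contDiffAt_fderiv h) (by norm_num)).continuousAt

lemma continuousWithinAt_state (hr : ContinuousWithinAt r J t) :
    ContinuousWithinAt (fun s => (s, r s)) J t :=
  continuousWithinAt_id.prodMk hr

lemma eventually_regular (hr : ContinuousWithinAt r J t) (hR : Regular D (t, r t)) :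
    ∀ᶠ s in 𝓝[J] t, Regular D (s, r s) :=
  (continuousWithinAt_state hr).eventually hR.eventually

lemma continuousWithinAt_field (hr : ContinuousWithinAt r J t) (hR : Regular D (t, r t)) :
    ContinuousWithinAt (fun s => field D (s, r s)) J t :=
  hR.1.continuousAt.comp_continuousWithinAt (f := fun s => (s, r s))
    (continuousWithinAt_state hr)

lemma continuousWithinAt_flow (hr : ContinuousWithinAt r J t)
    (hθ : ContinuousWithinAt θ J t) (hR : Regular D (t, r t)) (v : ℝ) :
    ContinuousWithinAt (fun s => flow D v (s, r s) (θ s)) J t := by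
  have h1 := (continuousAt_fderiv_field hR.1).comp_continuousWithinAt (f := fun s => (s, r s))
    (continuousWithinAt_state hr)
  have h2 := continuous_dir.continuousAt.comp_continuousWithinAt hθ
  exact h1.clm_apply (continuousWithinAt_const.prodMk (continuousWithinAt_const.mul h2))

lemma continuousWithinAt_steer (hr : ContinuousWithinAt r J t)
    (hθ : ContinuousWithinAt θ J t) (hR : Regular D (t, r t)) (v : ℝ) :
    ContinuousWithinAt (fun s => steer D v (s, r s) (θ s)) J t := by
  have h1 := (continuousAt_fderiv_field hR.1).comp_continuousWithinAt (f := fun s => (s, r s))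
    (continuousWithinAt_state hr)
  have h2 := continuous_dir.continuousAt.comp_continuousWithinAt hθ
  exact h1.clm_apply (continuousWithinAt_const.prodMk
    (continuousWithinAt_const.mul (continuousWithinAt_const.mul h2)))

lemma continuousWithinAt_drift (hr : ContinuousWithinAt r J t)
    (hθ : ContinuousWithinAt θ J t) (hR : Regular D (t, r t)) (v : ℝ) :
    ContinuousWithinAt (fun s => drift D v (s, r s) (θ s)) J t := by
  have h1 := (continuousAt_fderiv_fderiv_field hR.1).comp_continuousWithinAt
    (f := fun s => (s, r s)) (continuousWithinAt_state hr)
  have h2 := continuous_dir.continuousAt.comp_continuousWithinAt hθ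
  have h3 : ContinuousWithinAt (fun s => ((1 : ℝ), (v : ℂ) * dir (θ s))) J t :=
    continuousWithinAt_const.prodMk (continuousWithinAt_const.mul h2)
  exact (h1.clm_apply h3).clm_apply h3

lemma continuousWithinAt_switch (hr : ContinuousWithinAt r J t)
    (hθ : ContinuousWithinAt θ J t) (hR : Regular D (t, r t)) (hδ : 0 < δ) (v γ d₀ : ℝ) :
    ContinuousWithinAt (fun s => switch D v γ δ d₀ (s, r s) (θ s)) J t :=
  (continuousWithinAt_flow hr hθ hR v).add
    ((continuous_chi hδ).continuousAt.comp_continuousWithinAt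
      ((continuousWithinAt_field hr hR).sub continuousWithinAt_const))

lemma hasDerivWithinAt_state (hr : HasDerivWithinAt r (v * dir (θ t)) J t) :
    HasDerivWithinAt (fun s => (s, r s)) ((1 : ℝ), (v : ℂ) * dir (θ t)) J t :=
  (hasDerivWithinAt_id t J).prodMk hr

lemma hasDerivWithinAt_field (hr : HasDerivWithinAt r (v * dir (θ t)) J t)
    (hR : Regular D (t, r t)) :
    HasDerivWithinAt (fun s => field D (s, r s)) (flow D v (t, r t) (θ t)) J t :=
  (differentiableAt_field hR.1).hasFDerivAt.comp_hasDerivWithinAt (f := fun s => (s, r s)) t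
    (hasDerivWithinAt_state hr)

lemma hasDerivWithinAt_flow {c : ℝ} (hr : HasDerivWithinAt r (v * dir (θ t)) J t)
    (hθ : HasDerivWithinAt θ c J t) (hR : Regular D (t, r t)) :
    HasDerivWithinAt (fun s => flow D v (s, r s) (θ s))
      (drift D v (t, r t) (θ t) + c * steer D v (t, r t) (θ t)) J t := by
  have h1 := (hasFDerivAt_fderiv hR.1).comp_hasDerivWithinAt (f := fun s => (s, r s)) t
    (hasDerivWithinAt_state hr)
  have h2 : HasDerivWithinAt (fun s => dir (θ s)) (c • (Complex.I * dir (θ t))) J t :=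
    (hasDerivAt_dir (θ t)).scomp_hasDerivWithinAt t hθ
  have h3 := (hasDerivWithinAt_const t J (1 : ℝ)).prodMk (h2.const_mul (v : ℂ))
  refine HasDerivWithinAt.congr_deriv (h1.clm_apply h3) ?_
  have e : ((0 : ℝ), (v : ℂ) * (c • (Complex.I * dir (θ t)))) =
      c • ((0 : ℝ), (v : ℂ) * (Complex.I * dir (θ t))) := by
    simp only [Prod.smul_mk, smul_zero, Complex.real_smul]
    congr 1; ring
  rw [e, map_smul]
  simp [drift, steer, hess]

/-- The mean value theorem for the switching quantity, on a time interval where the turning rate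
is constant. -/
lemma exists_switch_sub (hγ : 0 < γ) (hδ : 0 < δ) {a b c : ℝ} (hab : a < b)
    (hr : ∀ s ∈ Icc a b, HasDerivWithinAt r (v * dir (θ s)) (Icc a b) s)
    (hθ : ∀ s ∈ Icc a b, HasDerivWithinAt θ c (Icc a b) s)
    (hR : ∀ s ∈ Icc a b, Regular D (s, r s)) :
    ∃ x ∈ Ioo a b, ∃ m, 0 ≤ m ∧ m ≤ γ ∧
      switch D v γ δ d₀ (b, r b) (θ b) - switch D v γ δ d₀ (a, r a) (θ a) =
        (drift D v (x, r x) (θ x) + c * steer D v (x, r x) (θ x) + m * flow D v (x, r x) (θ x))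
          * (b - a) := by
  -- With the chord slope `m` frozen, `ḋ + m d` is differentiable and has the same increment over
  -- `[a, b]` as the switching quantity.
  obtain ⟨m, hm0, hmγ, hm⟩ :=
    exists_chi_sub hγ hδ (field D (a, r a) - d₀) (field D (b, r b) - d₀)
  have hder : ∀ s ∈ Icc a b, HasDerivWithinAt
      (fun s => flow D v (s, r s) (θ s) + m * field D (s, r s))
      (drift D v (s, r s) (θ s) + c * steer D v (s, r s) (θ s) + m * flow D v (s, r s) (θ s))
      (Icc a b) s := fun s hs =>
    (hasDerivWithinAt_flow (hr s hs) (hθ s hs) (hR s hs)).add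
      ((hasDerivWithinAt_field (hr s hs) (hR s hs)).const_mul m)
  obtain ⟨x, hx, hxe⟩ := exists_hasDerivAt_eq_slope _ _ hab
    (fun s hs => (hder s hs).continuousWithinAt)
    (fun s hs => (hder s (Ioo_subset_Icc_self hs)).hasDerivAt (Icc_mem_nhds hs.1 hs.2))
  refine ⟨x, hx, m, hm0, hmγ, ?_⟩
  rw [hxe, div_mul_cancel₀ _ (sub_pos.2 hab).ne']
  simp only [switch]
  linear_combination hm

/-- What the tuning of the controller provides on the operational zone. -/
structure Controlled (D : ℝ → ℂ → ℝ) (dlo dhi v ubar γ δ d₀ : ℝ) : Prop where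
  gamma_pos : 0 < γ
  delta_pos : 0 < δ
  ubar_pos : 0 < ubar
  lo_le : dlo ≤ d₀
  le_hi : d₀ ≤ dhi
  closed : IsClosed (zone D dlo dhi)
  regular : ∀ q ∈ zone D dlo dhi, Regular D q
  dominated : ∀ q ∈ zone D dlo dhi, ∀ φ, switch D v γ δ d₀ q φ = 0 →
    |drift D v q φ| + γ * |flow D v q φ| < ubar * |steer D v q φ|
  switch_pos : ∀ q ∈ zone D dlo dhi, ∀ φ, dir φ = normal D q.1 q.2 → 0 < switch D v γ δ d₀ q φ
  switch_neg : ∀ q ∈ zone D dlo dhi, ∀ φ, dir φ = -normal D q.1 q.2 → switch D v γ δ d₀ q φ < 0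

lemma Controlled.steer_ne_zero (hc : Controlled D dlo dhi v ubar γ δ d₀)
    (hq : q ∈ zone D dlo dhi) {φ : ℝ} (h : switch D v γ δ d₀ q φ = 0) : steer D v q φ ≠ 0 := by
  intro h0
  have := hc.dominated q hq φ h
  rw [h0, abs_zero, mul_zero] at this
  nlinarith [abs_nonneg (drift D v q φ), abs_nonneg (flow D v q φ), hc.gamma_pos]

/-- A strict inequality between continuous quantities is open. The neighbouring points need lie
neither in the zone nor on the surface, so it is available before the motion is known to stay in
either. -/
lemma Controlled.eventually_dominated (hc : Controlled D dlo dhi v ubar γ δ d₀)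
    (hr : ContinuousWithinAt r J t) (hθ : ContinuousWithinAt θ J t)
    (hq : (t, r t) ∈ zone D dlo dhi) (h : switch D v γ δ d₀ (t, r t) (θ t) = 0) :
    ∀ᶠ s in 𝓝[J] t, Regular D (s, r s) ∧
      |drift D v (s, r s) (θ s)| + γ * |flow D v (s, r s) (θ s)|
        < ubar * |steer D v (s, r s) (θ s)| := by
  have hR := hc.regular _ hq
  refine (eventually_regular hr hR).and ?_
  exact Tendsto.eventually_lt
    ((continuousWithinAt_drift hr hθ hR v).abs.add
      (continuousWithinAt_const.mul (continuousWithinAt_flow hr hθ hR v).abs))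
    (continuousWithinAt_const.mul (continuousWithinAt_steer hr hθ hR v).abs)
    (hc.dominated _ hq _ h)

/-- On a domain where the turning rate dominates, its sign determines the sense in which the
switching quantity varies. -/
lemma dominated_sign {P F Q m w : ℝ} (hm0 : 0 ≤ m) (hm : m ≤ γ)
    (h : |P| + γ * |F| < ubar * |Q|) (hw : ubar * |Q| = w * Q) : 0 < P + w * Q + m * F := by
  have h1 : m * |F| ≤ γ * |F| := by gcongr
  have h2 := neg_abs_le P
  have h3 : -(m * |F|) ≤ m * F := by nlinarith [neg_abs_le F]
  linarith

/-- A motion of the closed-loop system on `[0, τ]`, with the control law required only where the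
field is regular. -/
structure Motion (D : ℝ → ℂ → ℝ) (v ubar γ δ d₀ : ℝ) (θin : ℝ) (τ : ℝ) (r : ℝ → ℂ)
    (θ u : ℝ → ℝ) : Prop where
  velocity : ∀ t ∈ Icc 0 τ, HasDerivWithinAt r (v * dir (θ t)) (Icc 0 τ) t
  integrable : IntervalIntegrable u volume 0 τ
  heading : ∀ t ∈ Icc 0 τ, θ t = θin + ∫ s in (0 : ℝ)..t, u s
  law_pos : ∀ᵐ t, t ∈ Icc 0 τ → Regular D (t, r t) →
    0 < switch D v γ δ d₀ (t, r t) (θ t) → u t = -ubar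
  law_neg : ∀ᵐ t, t ∈ Icc 0 τ → Regular D (t, r t) →
    switch D v γ δ d₀ (t, r t) (θ t) < 0 → u t = ubar

section Motion

variable {θin τ : ℝ}

/-- The sign `e` of the switching quantity lets both branches of the control law be treated at once.
-/
lemma Motion.law_sign (hM : Motion D v ubar γ δ d₀ θin τ r θ u) {e : ℝ}
    (he : e ∈ ({1, -1} : Set ℝ)) : ∀ᵐ t, t ∈ Icc 0 τ → Regular D (t, r t) →
      0 < e * switch D v γ δ d₀ (t, r t) (θ t) → u t = -e * ubar := by
  rcases he with rfl | rfl
  · simpa using hM.law_pos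
  · simpa using hM.law_neg

lemma Motion.continuousOn_heading (hτ : 0 ≤ τ) (hM : Motion D v ubar γ δ d₀ θin τ r θ u) :
    ContinuousOn θ (Icc 0 τ) := by
  have h1 := intervalIntegral.continuousOn_primitive_interval
    ((intervalIntegrable_iff' (by simp)).1 hM.integrable)
  rw [uIcc_of_le hτ] at h1
  exact (continuousOn_const.add h1).congr hM.heading

lemma Motion.continuousOn_position (hM : Motion D v ubar γ δ d₀ θin τ r θ u) :
    ContinuousOn r (Icc 0 τ) := fun t ht => (hM.velocity t ht).continuousWithinAt

/-- The heading is an affine function of time while the switching quantity has a constant sign. -/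
lemma Motion.heading_eq (hM : Motion D v ubar γ δ d₀ θin τ r θ u) {e a b : ℝ}
    (he : e ∈ ({1, -1} : Set ℝ)) (ha : 0 ≤ a) (hb : b ≤ τ)
    (hS : ∀ t ∈ Ioo a b, Regular D (t, r t) ∧ 0 < e * switch D v γ δ d₀ (t, r t) (θ t)) :
    ∀ t ∈ Icc a b, θ t = θ a + -e * ubar * (t - a) := by
  intro t ht
  have hat := ht.1
  have hsub : ∀ x ∈ Icc a b, IntervalIntegrable u volume 0 x := fun x hx =>
    hM.integrable.mono_set (by
      rw [uIcc_of_le (ha.trans hx.1), uIcc_of_le (ha.trans (hx.1.trans (hx.2.trans hb)))]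
      exact Icc_subset_Icc_right (hx.2.trans hb))
  have h1 : ∫ s in a..t, u s = -e * ubar * (t - a) := by
    have h2 : ∫ s in a..t, u s = ∫ _ in a..t, -e * ubar := by
      refine intervalIntegral.integral_congr_ae ?_
      have hne : ∀ᵐ s : ℝ, s ≠ t := by simp [ae_iff, measure_singleton]
      filter_upwards [hM.law_sign he, hne] with s hs hst hm
      rw [uIoc_of_le hat] at hm
      have hs' : s ∈ Ioo a b := ⟨hm.1, (lt_of_le_of_ne hm.2 hst).trans_le ht.2⟩
      exact hs ⟨ha.trans hm.1.le, hm.2.trans (ht.2.trans hb)⟩ (hS s hs').1 (hS s hs').2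
    rw [h2, intervalIntegral.integral_const, smul_eq_mul, mul_comm]
  have hab := hat.trans ht.2
  rw [hM.heading t ⟨ha.trans hat, ht.2.trans hb⟩, hM.heading a ⟨ha, hab.trans hb⟩, ← h1,
    add_assoc, intervalIntegral.integral_add_adjacent_intervals (hsub a ⟨le_rfl, hab⟩)
      ((hsub a ⟨le_rfl, hab⟩).symm.trans (hsub t ht))]

end Motion

/-- The last moment at which a continuous function that becomes positive is nonpositive. -/
lemma exists_last_nonpos {f : ℝ → ℝ} {a b : ℝ} (hab : a ≤ b) (hf : ContinuousOn f (Icc a b))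
    (ha : f a ≤ 0) (hb : 0 < f b) :
    ∃ c ∈ Ico a b, f c ≤ 0 ∧ ∀ x ∈ Ioc c b, 0 < f x := by
  have hcl : IsClosed (Icc a b ∩ f ⁻¹' Iic 0) := hf.preimage_isClosed_of_isClosed isClosed_Icc
    isClosed_Iic
  obtain ⟨c, hc⟩ := (isCompact_Icc.of_isClosed_subset hcl inter_subset_left).exists_isGreatest
    ⟨a, ⟨left_mem_Icc.2 hab, ha⟩⟩
  refine ⟨c, ⟨hc.1.1.1, lt_of_le_of_ne hc.1.1.2 ?_⟩, hc.1.2, fun x hx => ?_⟩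
  · rintro rfl
    exact absurd hb (not_lt.2 hc.1.2)
  · by_contra h
    exact absurd (hc.2 ⟨⟨hc.1.1.1.trans hx.1.le, hx.2⟩, not_lt.1 h⟩) (not_le.2 hx.1)

section Motion

variable {θin τ : ℝ}

/-- The discontinuity surface attracts the vehicle that travels in the positive direction
relative to the isoline. -/
lemma Motion.eventually_switch_eq_zero (hc : Controlled D dlo dhi v ubar γ δ d₀)
    (hM : Motion D v ubar γ δ d₀ θin τ r θ u) (ht : t ∈ Ico 0 τ)
    (hq : (t, r t) ∈ zone D dlo dhi) (h0 : switch D v γ δ d₀ (t, r t) (θ t) = 0)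
    (hQ : 0 < steer D v (t, r t) (θ t)) :
    ∃ b ∈ Ioc t τ, ∀ s ∈ Icc t b, Regular D (s, r s) ∧
      switch D v γ δ d₀ (s, r s) (θ s) = 0 ∧ 0 < steer D v (s, r s) (θ s) := by
  have hτ : 0 ≤ τ := ht.1.trans ht.2.le
  have hrc := hM.continuousOn_position
  have hθc := hM.continuousOn_heading hτ
  have htI : t ∈ Icc 0 τ := Ico_subset_Icc_self ht
  have hev := (hc.eventually_dominated (hrc t htI) (hθc t htI) hq h0).and
    ((continuousWithinAt_steer (hrc t htI) (hθc t htI) (hc.regular _ hq) v).eventually_const_lt hQ)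
  have hev' := hev.filter_mono (nhdsWithin_mono t (Icc_subset_Icc_left ht.1))
  obtain ⟨b, hb, hbs⟩ : ∃ b ∈ Ioc t τ, ∀ s ∈ Icc t b, (Regular D (s, r s) ∧
      |drift D v (s, r s) (θ s)| + γ * |flow D v (s, r s) (θ s)|
        < ubar * |steer D v (s, r s) (θ s)|) ∧ 0 < steer D v (s, r s) (θ s) := by
    rw [nhdsWithin_Icc_eq_nhdsGE ht.2] at hev'
    obtain ⟨b, hb1, hb2⟩ := (mem_nhdsGE_iff_exists_Icc_subset).1 hev'
    refine ⟨min b τ, ⟨lt_min hb1 ht.2, min_le_right _ _⟩, fun s hs => ?_⟩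
    exact hb2 ⟨hs.1, hs.2.trans (min_le_left _ _)⟩
  have hsub : Icc t b ⊆ Icc 0 τ := Icc_subset_Icc ht.1 hb.2
  refine ⟨b, hb, fun s hs => ⟨(hbs s hs).1.1, ?_, (hbs s hs).2⟩⟩
  have hcont : ContinuousOn (fun s => switch D v γ δ d₀ (s, r s) (θ s)) (Icc t b) := fun x hx =>
    continuousWithinAt_switch ((hrc x (hsub hx)).mono hsub) ((hθc x (hsub hx)).mono hsub)
      (hbs x hx).1.1 hc.delta_pos v γ d₀
  -- If `e S > 0` at `s`, then after the last moment `a` with `e S ≤ 0` the control is constantly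
  -- `-e ubar`. Since `Q > 0`, this control makes `e S` decrease over `[a, s]`, a contradiction.
  have key : ∀ e ∈ ({1, -1} : Set ℝ), e * switch D v γ δ d₀ (s, r s) (θ s) ≤ 0 := by
    intro e he
    by_contra hpos
    obtain ⟨a, ha, ha0, hapos⟩ := exists_last_nonpos hs.1
      (f := fun s => e * switch D v γ δ d₀ (s, r s) (θ s))
      (continuousOn_const.mul (hcont.mono (Icc_subset_Icc_right hs.2)))
      (by simp [h0]) (not_le.1 hpos)
    have hsub' : Icc a s ⊆ Icc t b := Icc_subset_Icc ha.1 hs.2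
    have hθ := hM.heading_eq (a := a) (b := s) he (ht.1.trans ha.1) (hs.2.trans hb.2)
      (fun x hx => ⟨(hbs x (hsub' (Ioo_subset_Icc_self hx))).1.1, hapos x ⟨hx.1, hx.2.le⟩⟩)
    obtain ⟨x, hx, m, hm0, hm, hxe⟩ := exists_switch_sub (D := D) (r := r) (θ := θ) (v := v)
      (d₀ := d₀) hc.gamma_pos hc.delta_pos (c := -e * ubar) ha.2
      (fun x hx => (hM.velocity x (hsub (hsub' hx))).mono (hsub'.trans hsub))
      (fun x hx => by
        have h1 : HasDerivWithinAt (fun t => θ a + -e * ubar * (t - a)) (-e * ubar) (Icc a s) x := by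
          simpa using ((((hasDerivWithinAt_id x (Icc a s)).sub_const a).const_mul
            (-e * ubar)).const_add (θ a))
        exact h1.congr hθ (hθ x hx))
      (fun x hx => (hbs x (hsub' hx)).1.1)
    obtain ⟨⟨-, h1⟩, h2⟩ := hbs x (hsub' (Ioo_subset_Icc_self hx))
    have hpos' := not_le.1 hpos
    have hlen : 0 < s - a := sub_pos.2 ha.2
    rcases he with rfl | rfl
    · have := dominated_sign (P := -drift D v (x, r x) (θ x)) (F := -flow D v (x, r x) (θ x))
        (w := ubar) hm0 hm (by simpa using h1) (by rw [abs_of_pos h2])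
      nlinarith
    · have := dominated_sign (w := ubar) hm0 hm h1 (by rw [abs_of_pos h2])
      nlinarith
  have h1 := key 1 (by simp)
  have h2 := key (-1) (by simp)
  linarith

end Motion

end Dynamics

/-! ### Persistence of sliding and exponential decay of the error -/

section SlidingMode

variable {D : ℝ → ℂ → ℝ} {q : ℝ × ℂ} {t : ℝ} {r : ℝ → ℂ} {θ u : ℝ → ℝ} {J : Set ℝ}
  {v γ δ d₀ ubar dlo dhi θin τ : ℝ}

lemma chi_neg (γ δ p : ℝ) : chi γ δ (-p) = -chi γ δ p := by
  simp only [chi, abs_neg, Real.sign_neg]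
  split_ifs <;> ring

/-- For `0 ≤ p ≤ B` the graph of `χ` lies above its chord, of slope `γδ/B`; oddness gives the other
half. -/
lemma chi_mul_self_ge {γ δ B p : ℝ} (hγ : 0 < γ) (hδ : 0 < δ) (hB : δ ≤ B) (hp : |p| ≤ B) :
    γ * (δ / B) * p ^ 2 ≤ p * chi γ δ p := by
  have hB0 : 0 < B := hδ.trans_le hB
  have h1 : δ / B ≤ 1 := (div_le_one hB0).2 hB
  have h2 : ∀ p : ℝ, 0 ≤ p → p ≤ B → γ * (δ / B) * p ^ 2 ≤ p * chi γ δ p := by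
    intro p h0 hpB
    rcases le_total δ p with h | h
    · rw [chi_of_le hδ h]
      have : γ * (δ / B) * p ^ 2 = p * (γ * δ) * (p / B) := by field_simp
      rw [this]
      exact mul_le_of_le_one_right (by positivity) ((div_le_one hB0).2 hpB)
    · rw [chi, if_pos (abs_le.2 ⟨by linarith, h⟩)]
      have : p * (γ * p) = γ * 1 * p ^ 2 := by ring
      rw [this]
      gcongr
  rcases le_total 0 p with h | h
  · exact h2 p h ((le_abs_self p).trans hp)
  · have := h2 (-p) (by linarith) ((neg_le_abs p).trans hp)
    rw [chi_neg] at this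
    linarith

/-- A solution of `ḋ = -χ(d - d₀)` does not rise above a level that is greater than `d₀`. -/
lemma le_of_deriv_eq_neg_chi {d : ℝ → ℝ} {a b c : ℝ} (hγ : 0 < γ) (hδ : 0 < δ)
    (hd : ∀ s ∈ Icc a b, HasDerivWithinAt d (-chi γ δ (d s - d₀)) (Icc a b) s)
    (hc : d₀ ≤ c) (ha : d a ≤ c) : ∀ s ∈ Icc a b, d s ≤ c := by
  intro s hs
  by_contra h
  have hcont : ContinuousOn d (Icc a b) := fun x hx => (hd x hx).continuousWithinAt
  obtain ⟨e, he, he0, hpos⟩ := exists_last_nonpos (f := fun x => d x - c) hs.1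
    ((hcont.mono (Icc_subset_Icc_right hs.2)).sub continuousOn_const) (by simpa using ha)
    (by simpa using h)
  obtain ⟨x, hx, hxe⟩ := exists_hasDerivAt_eq_slope d _ he.2
    (hcont.mono (Icc_subset_Icc he.1 hs.2))
    (fun x hx => (hd x ⟨he.1.trans hx.1.le, hx.2.le.trans hs.2⟩).hasDerivAt
      (Icc_mem_nhds (he.1.trans_lt hx.1) (hx.2.trans_le hs.2)))
  have h1 : 0 ≤ chi γ δ (d x - d₀) := by
    have h2 := hpos x ⟨hx.1, hx.2.le⟩
    rw [chi_eq_max_min hδ]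
    have : 0 ≤ min δ (d x - d₀) := le_min hδ.le (by linarith)
    exact mul_nonneg hγ.le (this.trans (le_max_right _ _))
  have h3 : 0 < s - e := sub_pos.2 he.2
  rw [eq_div_iff h3.ne'] at hxe
  nlinarith

lemma mem_Icc_of_deriv_eq_neg_chi {d : ℝ → ℝ} {a b : ℝ} (hγ : 0 < γ) (hδ : 0 < δ)
    (hd : ∀ s ∈ Icc a b, HasDerivWithinAt d (-chi γ δ (d s - d₀)) (Icc a b) s)
    (hlo : dlo ≤ d₀) (hhi : d₀ ≤ dhi) (ha : d a ∈ Icc dlo dhi) :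
    ∀ s ∈ Icc a b, d s ∈ Icc dlo dhi := by
  intro s hs
  refine ⟨?_, le_of_deriv_eq_neg_chi hγ hδ hd hhi ha.2 s hs⟩
  have h := le_of_deriv_eq_neg_chi (d := fun s => -d s) (d₀ := -d₀) (c := -dlo) hγ hδ
    (fun s hs => (hd s hs).neg.congr_deriv (by
      rw [neg_neg, ← chi_neg]; congr 1; ring)) (by linarith) (by linarith [ha.1]) s hs
  linarith

lemma Motion.hasDerivWithinAt_field_of_switch (hM : Motion D v ubar γ δ d₀ θin τ r θ u)
    {a b : ℝ} (ha : 0 ≤ a) (hb : b ≤ τ) {s : ℝ} (hs : s ∈ Icc a b) (hR : Regular D (s, r s))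
    (hS : switch D v γ δ d₀ (s, r s) (θ s) = 0) :
    HasDerivWithinAt (fun s => field D (s, r s)) (-chi γ δ (field D (s, r s) - d₀))
      (Icc a b) s := by
  have hsub : Icc a b ⊆ Icc 0 τ := Icc_subset_Icc ha hb
  refine (hasDerivWithinAt_field ((hM.velocity s (hsub hs)).mono hsub) hR).congr_deriv ?_
  simp only [switch] at hS
  linarith

/-- Once sliding along the attracting part of the discontinuity surface has started inside the
operational zone, it never terminates. -/
lemma Motion.sliding (hc : Controlled D dlo dhi v ubar γ δ d₀)
    (hM : Motion D v ubar γ δ d₀ θin τ r θ u) {t₀ : ℝ} (ht₀ : t₀ ∈ Icc 0 τ)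
    (hq : (t₀, r t₀) ∈ zone D dlo dhi) (h0 : switch D v γ δ d₀ (t₀, r t₀) (θ t₀) = 0)
    (hQ : 0 < steer D v (t₀, r t₀) (θ t₀)) :
    ∀ t ∈ Icc t₀ τ, (t, r t) ∈ zone D dlo dhi ∧ switch D v γ δ d₀ (t, r t) (θ t) = 0 := by
  have hτ : 0 ≤ τ := ht₀.1.trans ht₀.2
  have hrc := hM.continuousOn_position
  have hθc := hM.continuousOn_heading hτ
  set A : Set ℝ := {t | (t, r t) ∈ zone D dlo dhi ∧ switch D v γ δ d₀ (t, r t) (θ t) = 0 ∧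
    0 < steer D v (t, r t) (θ t)} with hA
  have hsub : Icc t₀ τ ⊆ Icc 0 τ := Icc_subset_Icc_left ht₀.1
  suffices h : Icc t₀ τ ⊆ A from fun t ht => ⟨(h ht).1, (h ht).2.1⟩
  -- Continuation in time. In the limit `Q > 0` weakens to `Q ≥ 0`, and `steer_ne_zero` restores
  -- strictness. To the right, local sliding gives `ḋ = -χ(d - d₀)`, which keeps the reading within
  -- the zone bounds.
  refine IsClosed.Icc_subset_of_forall_mem_nhdsWithin ?_ ⟨hq, h0, hQ⟩ ?_
  · refine isClosed_of_closure_subset fun t ht => ?_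
    have htI : t ∈ Icc t₀ τ :=
      closure_minimal inter_subset_right isClosed_Icc ht
    have hne : (𝓝[A ∩ Icc t₀ τ] t).NeBot := mem_closure_iff_nhdsWithin_neBot.1 ht
    have hsub' : A ∩ Icc t₀ τ ⊆ Icc 0 τ := inter_subset_right.trans hsub
    have hrt := (hrc t (hsub htI)).mono hsub'
    have hθt := (hθc t (hsub htI)).mono hsub'
    have hz : (t, r t) ∈ zone D dlo dhi := by
      refine hc.closed.mem_of_tendsto (continuousWithinAt_state hrt) ?_
      filter_upwards [self_mem_nhdsWithin] with s hs using hs.1.1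
    have hR := hc.regular _ hz
    have hS : switch D v γ δ d₀ (t, r t) (θ t) = 0 := by
      refine tendsto_nhds_unique
        (continuousWithinAt_switch hrt hθt hR hc.delta_pos v γ d₀).tendsto ?_
      refine tendsto_const_nhds.congr' ?_
      filter_upwards [self_mem_nhdsWithin] with s hs using hs.1.2.1.symm
    have hQ : 0 ≤ steer D v (t, r t) (θ t) := by
      refine ge_of_tendsto (continuousWithinAt_steer hrt hθt hR v).tendsto ?_
      filter_upwards [self_mem_nhdsWithin] with s hs using hs.1.2.2.le
    exact ⟨⟨hz, hS, lt_of_le_of_ne hQ (hc.steer_ne_zero hz hS).symm⟩, htI⟩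
  · rintro t ⟨⟨hz, hS, hQ⟩, htI⟩
    have ht0 : 0 ≤ t := ht₀.1.trans htI.1
    obtain ⟨b, hb, hbs⟩ := hM.eventually_switch_eq_zero hc ⟨ht0, htI.2⟩ hz hS hQ
    have hd := mem_Icc_of_deriv_eq_neg_chi (d := fun s => field D (s, r s)) (a := t) (b := b)
      hc.gamma_pos hc.delta_pos
      (fun s hs => hM.hasDerivWithinAt_field_of_switch ht0 hb.2 hs (hbs s hs).1 (hbs s hs).2.1)
      hc.lo_le hc.le_hi ⟨hz.2.1, hz.2.2⟩
    refine mem_of_superset (Ioc_mem_nhdsGT hb.1) fun s hs => ?_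
    have hs' : s ∈ Icc t b := Ioc_subset_Icc_self hs
    exact ⟨⟨ht0.trans hs.1.le, hd s hs'⟩, (hbs s hs').2⟩

/-- The tracking error decays exponentially in the sliding mode. -/
lemma Motion.sliding_decay (hc : Controlled D dlo dhi v ubar γ δ d₀)
    (hM : Motion D v ubar γ δ d₀ θin τ r θ u) {t₀ B : ℝ} (ht₀ : t₀ ∈ Icc 0 τ) (hB : δ ≤ B)
    (hBz : ∀ x ∈ Icc dlo dhi, |x - d₀| ≤ B)
    (h : ∀ t ∈ Icc t₀ τ, (t, r t) ∈ zone D dlo dhi ∧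
      switch D v γ δ d₀ (t, r t) (θ t) = 0) :
    ∀ t ∈ Icc t₀ τ, (field D (t, r t) - d₀) ^ 2 ≤
      B ^ 2 * Real.exp (-(2 * (γ * (δ / B))) * (t - t₀)) := by
  intro t ht
  set κ := 2 * (γ * (δ / B)) with hκ
  have hder : ∀ s ∈ Icc t₀ τ, HasDerivWithinAt
      (fun s => (field D (s, r s) - d₀) ^ 2 * Real.exp (κ * (s - t₀)))
      ((2 * (field D (s, r s) - d₀) * -chi γ δ (field D (s, r s) - d₀)) *
        Real.exp (κ * (s - t₀)) + (field D (s, r s) - d₀) ^ 2 *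
          (Real.exp (κ * (s - t₀)) * κ)) (Icc t₀ τ) s := by
    intro s hs
    have h1 := ((hM.hasDerivWithinAt_field_of_switch ht₀.1 le_rfl hs
      (hc.regular _ (h s hs).1) (h s hs).2).sub_const d₀).pow 2
    have h2 := ((((hasDerivWithinAt_id s (Icc t₀ τ)).sub_const t₀).const_mul κ)).exp
    refine (h1.mul h2).congr_deriv ?_
    simp
  -- A Lyapunov argument: the squared error decays at least at the rate `κ`, twice the chord slope
  -- of `chi_mul_self_ge`.
  have hanti : AntitoneOn (fun s => (field D (s, r s) - d₀) ^ 2 * Real.exp (κ * (s - t₀)))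
      (Icc t₀ τ) := by
    refine antitoneOn_of_hasDerivWithinAt_nonpos (convex_Icc _ _)
      (fun s hs => (hder s hs).continuousWithinAt)
      (fun s hs => (hder s (interior_subset hs)).mono interior_subset) fun s hs => ?_
    have hs' := h s (interior_subset hs)
    have h1 := chi_mul_self_ge hc.gamma_pos hc.delta_pos hB
      (hBz (field D (s, r s)) ⟨hs'.1.2.1, hs'.1.2.2⟩)
    have h2 : (2 * (field D (s, r s) - d₀) * -chi γ δ (field D (s, r s) - d₀)) *
        Real.exp (κ * (s - t₀)) + (field D (s, r s) - d₀) ^ 2 * (Real.exp (κ * (s - t₀)) * κ)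
        = -(2 * ((field D (s, r s) - d₀) * chi γ δ (field D (s, r s) - d₀)
          - γ * (δ / B) * (field D (s, r s) - d₀) ^ 2)) * Real.exp (κ * (s - t₀)) := by
      rw [hκ]; ring
    rw [h2]
    exact mul_nonpos_of_nonpos_of_nonneg (by linarith) (Real.exp_pos _).le
  have h3 := hanti (left_mem_Icc.2 ht₀.2) ht ht.1
  simp only [sub_self, mul_zero, Real.exp_zero, mul_one] at h3
  have hz0 := (h t₀ (left_mem_Icc.2 ht₀.2)).1
  have h4 : (field D (t₀, r t₀) - d₀) ^ 2 ≤ B ^ 2 := by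
    rw [← sq_abs]
    gcongr
    exact hBz _ ⟨hz0.2.1, hz0.2.2⟩
  have h5 := h3.trans h4
  rw [neg_mul, Real.exp_neg, ← div_eq_mul_inv, le_div_iff₀ (Real.exp_pos _)]
  exact h5

end SlidingMode

/-! ### Rotation of the gradient along the initial circles -/

section Rotation

variable {D : ℝ → ℂ → ℝ} {q : ℝ × ℂ} {t : ℝ} {r : ℝ → ℂ} {θ u : ℝ → ℝ} {J : Set ℝ}
  {v γ δ d₀ ubar dlo dhi θin τ : ℝ}

lemma dir_add (a b : ℝ) : dir (a + b) = dir a * dir b := by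
  simp [dir, add_mul, Complex.exp_add]

lemma norm_mul_dir_arg (z : ℂ) : (‖z‖ : ℂ) * dir (Complex.arg z) = z :=
  Complex.norm_mul_exp_arg_mul_I z

/-- A continuous polar angle of a path is carried over to a close path with the same ends, with
the same total increment. -/
lemma exists_polar_angle_of_close {T : ℝ} (hT : 0 ≤ T) {f g : ℝ → ℂ} {φ : ℝ → ℝ}
    (hf : ContinuousOn f (Icc 0 T)) (hg : ContinuousOn g (Icc 0 T))
    (hφ : ContinuousOn φ (Icc 0 T)) (hfφ : ∀ t ∈ Icc 0 T, f t = ‖f t‖ * dir (φ t))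
    (hf0 : ∀ t ∈ Icc 0 T, f t ≠ 0)
    (hclose : ∀ t ∈ Icc 0 T, ‖g t - f t‖ < ‖f t‖) (h0 : f 0 = g 0) (hend : f T = g T) :
    ∃ ψ : ℝ → ℝ, ContinuousOn ψ (Icc 0 T) ∧ (∀ t ∈ Icc 0 T, g t = ‖g t‖ * dir (ψ t)) ∧
      ψ T - ψ 0 = φ T - φ 0 := by
  have hslit : ∀ t ∈ Icc 0 T, g t / f t ∈ Complex.slitPlane := by
    intro t ht
    have h1 : ‖g t / f t - 1‖ < 1 := by
      rw [div_sub_one (hf0 t ht), norm_div, div_lt_one (norm_pos_iff.2 (hf0 t ht))]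
      exact hclose t ht
    have h2 := (Complex.abs_re_le_norm (g t / f t - 1)).trans_lt h1
    rw [Complex.sub_re, Complex.one_re] at h2
    exact Or.inl (by linarith [(abs_lt.1 h2).1])
  -- Closeness puts `g / f` in the open unit disc about `1`, where the principal argument is
  -- continuous; at both ends the quotient is `1` and the correction vanishes.
  refine ⟨fun t => φ t + Complex.arg (g t / f t), ?_, fun t ht => ?_, ?_⟩
  · intro t ht
    exact (hφ t ht).add ((Complex.continuousAt_arg (hslit t ht)).comp_continuousWithinAt
      (f := fun t => g t / f t) ((hg t ht).div (hf t ht) (hf0 t ht)))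
  · have h1 := norm_mul_dir_arg (g t / f t)
    have h2 : (‖g t‖ : ℂ) = ‖f t‖ * ‖g t / f t‖ := by
      rw [← Complex.ofReal_mul, ← norm_mul, mul_div_cancel₀ _ (hf0 t ht)]
    rw [dir_add, h2]
    calc g t = f t * (g t / f t) := (mul_div_cancel₀ _ (hf0 t ht)).symm
      _ = (‖f t‖ * dir (φ t)) * (‖g t / f t‖ * dir (Complex.arg (g t / f t))) := by
        rw [h1, ← hfφ t ht]
      _ = _ := by ring
  · simp only [← h0, ← hend]
    rw [div_self (hf0 0 (left_mem_Icc.2 hT)), div_self (hf0 T (right_mem_Icc.2 hT))]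
    simp

/-- The total increment of a continuous polar angle is invariant under homotopies that keep the
ends fixed. -/
lemma exists_polar_angle_of_homotopy {T : ℝ} (hT : 0 ≤ T) {H : ℝ × ℝ → ℂ} {φ : ℝ → ℝ}
    (hH : ContinuousOn H (Icc 0 1 ×ˢ Icc 0 T)) (hH0 : ∀ p ∈ Icc (0 : ℝ) 1 ×ˢ Icc 0 T, H p ≠ 0)
    (hleft : ∀ s ∈ Icc (0 : ℝ) 1, H (s, 0) = H (0, 0))
    (hright : ∀ s ∈ Icc (0 : ℝ) 1, H (s, T) = H (0, T))
    (hφ : ContinuousOn φ (Icc 0 T)) (hHφ : ∀ t ∈ Icc 0 T, H (0, t) = ‖H (0, t)‖ * dir (φ t)) :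
    ∃ ψ : ℝ → ℝ, ContinuousOn ψ (Icc 0 T) ∧ (∀ t ∈ Icc 0 T, H (1, t) = ‖H (1, t)‖ * dir (ψ t)) ∧
      ψ T - ψ 0 = φ T - φ 0 := by
  have hK : IsCompact (Icc (0 : ℝ) 1 ×ˢ Icc 0 T) := isCompact_Icc.prod isCompact_Icc
  -- The minimum of `‖H‖` serves as tolerance in uniform continuity, so that consecutive paths at
  -- homotopy parameters `i / n` are close in the sense of `exists_polar_angle_of_close`.
  obtain ⟨p₀, hp₀, hmin⟩ := hK.exists_isMinOn
    ⟨(0, 0), ⟨left_mem_Icc.2 zero_le_one, left_mem_Icc.2 hT⟩⟩ hH.norm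
  have hpos : 0 < ‖H p₀‖ := norm_pos_iff.2 (hH0 p₀ hp₀)
  have huc := Metric.uniformContinuousOn_iff.1 (hK.uniformContinuousOn_of_continuous hH) _ hpos
  obtain ⟨η, hη, hηH⟩ := huc
  obtain ⟨n, hn⟩ := exists_nat_gt (1 / η)
  have hn0 : (0 : ℝ) < n := (by positivity : 0 < 1 / η).trans hn
  have hcont : ∀ s ∈ Icc (0 : ℝ) 1, ContinuousOn (fun t => H (s, t)) (Icc 0 T) := fun s hs =>
    hH.comp (by fun_prop) fun t ht => ⟨hs, ht⟩
  have key : ∀ i : ℕ, i ≤ n → ∃ ψ : ℝ → ℝ, ContinuousOn ψ (Icc 0 T) ∧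
      (∀ t ∈ Icc 0 T, H ((i : ℝ) / n, t) = ‖H ((i : ℝ) / n, t)‖ * dir (ψ t)) ∧
      ψ T - ψ 0 = φ T - φ 0 := by
    intro i
    induction i with
    | zero => exact fun _ => ⟨φ, hφ, by simpa using hHφ, rfl⟩
    | succ i ih =>
      intro hi
      obtain ⟨ψ, h1, h2, h3⟩ := ih (by omega)
      have hi1 : (i : ℝ) / n ∈ Icc (0 : ℝ) 1 :=
        ⟨by positivity, (div_le_one hn0).2 (by exact_mod_cast (by omega : i ≤ n))⟩
      have hi2 : ((i + 1 : ℕ) : ℝ) / n ∈ Icc (0 : ℝ) 1 :=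
        ⟨by positivity, (div_le_one hn0).2 (by exact_mod_cast hi)⟩
      obtain ⟨ψ', h1', h2', h3'⟩ := exists_polar_angle_of_close hT
        (g := fun t => H (((i + 1 : ℕ) : ℝ) / n, t)) (hcont _ hi1) (hcont _ hi2) h1 h2
        (fun t ht => hH0 _ ⟨hi1, ht⟩)
        (fun t ht => by
          rw [← dist_eq_norm]
          refine (hηH _ ⟨hi2, ht⟩ _ ⟨hi1, ht⟩ ?_).trans_le (hmin ⟨hi1, ht⟩)
          rw [Prod.dist_eq, dist_self, max_eq_left dist_nonneg, Real.dist_eq]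
          have : ((i + 1 : ℕ) : ℝ) / n - i / n = 1 / n := by push_cast; ring
          rw [this, abs_of_pos (by positivity), div_lt_iff₀ hn0]
          rwa [div_lt_iff₀ hη, mul_comm] at hn)
        (by simp only [hleft _ hi1, hleft _ hi2]) (by simp only [hright _ hi1, hright _ hi2])
      exact ⟨ψ', h1', h2', h3'.trans h3⟩
  simpa [div_self hn0.ne'] using key n le_rfl

/-- The position at the time `t` of the vehicle that moves with the constant turning rate `w`. -/
def circlePath (v : ℝ) (rin : ℂ) (θin w t : ℝ) : ℂ :=
  rin + ((v / w : ℝ) : ℂ) * (Complex.I * dir θin)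
    - ((v / w : ℝ) : ℂ) * (Complex.I * dir (θin + w * t))

variable {rin : ℂ} {w : ℝ}

lemma circlePath_zero : circlePath v rin θin w 0 = rin := by simp [circlePath]

lemma hasDerivAt_affine (a w t : ℝ) : HasDerivAt (fun s : ℝ => a + w * s) w t := by
  simpa using ((hasDerivAt_id t).const_mul w).const_add a

lemma hasDerivAt_circlePath (hw : w ≠ 0) (t : ℝ) :
    HasDerivAt (circlePath v rin θin w) (v * dir (θin + w * t)) t := by
  have h1 := (hasDerivAt_dir (θin + w * t)).scomp t (hasDerivAt_affine θin w t)
  have h2 := ((h1.const_mul Complex.I).const_mul ((v / w : ℝ) : ℂ)).const_sub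
    (rin + ((v / w : ℝ) : ℂ) * (Complex.I * dir θin))
  refine HasDerivAt.congr_deriv h2 ?_
  have hw' : (w : ℂ) ≠ 0 := by exact_mod_cast hw
  simp only [Complex.real_smul]
  push_cast
  field_simp
  ring_nf
  simp

lemma circlePath_mem (hv : 0 < v) (t : ℝ) :
    circlePath v rin θin w t ∈ initialDisc v rin θin w := by
  rw [initialDisc, mem_closedBall_iff_norm]
  have h : circlePath v rin θin w t - (rin + ((v / w : ℝ) : ℂ) * (Complex.I * dir θin))
      = -(((v / w : ℝ) : ℂ) * (Complex.I * dir (θin + w * t))) := by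
    rw [circlePath]; ring
  rw [h, norm_neg, norm_mul, norm_mul, norm_dir, Complex.norm_real, Complex.norm_I]
  simp [abs_of_pos hv]

lemma dir_add_int_mul (a : ℝ) (k : ℤ) : dir (a + k * (2 * Real.pi)) = dir a := by
  rw [dir_add]
  have : dir (k * (2 * Real.pi)) = 1 := by
    rw [dir, Complex.exp_eq_one_iff]
    exact ⟨k, by push_cast; ring⟩
  rw [this, mul_one]

lemma circlePath_period (hubar : 0 < ubar) (hw : w ∈ ({ubar, -ubar} : Set ℝ)) (k : ℕ) :
    circlePath v rin θin w (2 * Real.pi * k / ubar) = rin := by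
  have h : ∃ j : ℤ, w * (2 * Real.pi * k / ubar) = j * (2 * Real.pi) := by
    rcases hw with rfl | rfl
    · exact ⟨k, by push_cast; field_simp⟩
    · exact ⟨-k, by push_cast; field_simp⟩
  obtain ⟨j, hj⟩ := h
  rw [circlePath, hj, dir_add_int_mul]
  ring

lemma exists_mem_Icc_add_int_mul {x y : ℝ} (h : x + 2 * Real.pi ≤ y) (a : ℝ) :
    ∃ k : ℤ, a + k * (2 * Real.pi) ∈ Icc x y := by
  have h1 := toIcoMod_mem_Ico Real.two_pi_pos x a
  have h2 := toIcoMod_add_toIcoDiv_zsmul Real.two_pi_pos x a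
  rw [zsmul_eq_mul] at h2
  refine ⟨-toIcoDiv Real.two_pi_pos x a, ?_, ?_⟩ <;> push_cast <;> linarith [h1.1, h1.2]

/-- While the vehicle makes `k` full turns, and the gradient at the initial point makes at most
`k - 1` turns, the heading takes every direction relative to the gradient. -/
lemma exists_dir_eq_normal (hv : 0 < v) (hubar : 0 < ubar) {k : ℕ}
    (hw : w ∈ ({ubar, -ubar} : Set ℝ))
    (hrot : GradientRotationLE D rin (2 * Real.pi * k / ubar) (2 * Real.pi * ((k : ℝ) - 1)))
    (hreg : ∀ t ∈ Icc (0 : ℝ) (2 * Real.pi * k / ubar), ∀ r ∈ initialDisc v rin θin w,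
      Regular D (t, r)) (a : ℝ) :
    ∃ t ∈ Icc (0 : ℝ) (2 * Real.pi * k / ubar),
      dir (θin + w * t) = dir a * normal D t (circlePath v rin θin w t) := by
  set T := 2 * Real.pi * k / ubar with hT
  have hT0 : 0 ≤ T := by positivity
  have hw0 : w ≠ 0 := by
    rcases hw with rfl | rfl
    · exact hubar.ne'
    · exact neg_ne_zero.2 hubar.ne'
  obtain ⟨φ, hφ, hφD, hφT⟩ := hrot
  set c := circlePath v rin θin w with hcdef
  have hcc : Continuous c := continuous_iff_continuousAt.2 fun t =>
    (hasDerivAt_circlePath hw0 t).continuousAt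
  have hmem : ∀ s ∈ Icc (0 : ℝ) 1, ∀ t, rin + s * (c t - rin) ∈ initialDisc v rin θin w := by
    intro s hs t
    have h1 : rin ∈ initialDisc v rin θin w := by
      have := circlePath_mem (rin := rin) (θin := θin) (w := w) hv 0
      rwa [circlePath_zero] at this
    have h2 := (convex_closedBall _ _).add_smul_sub_mem h1 (circlePath_mem hv t) hs
    rwa [Complex.real_smul] at h2
  -- The circle is contracted to `rin` along segments, which stay in the disc by convexity. The ends
  -- are fixed because the circle passes through `rin` at the times `0` and `T`.
  set H : ℝ × ℝ → ℂ := fun p => gradAt D (p.2, rin + p.1 * (c p.2 - rin)) with hH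
  have hc0 : c 0 = rin := circlePath_zero
  have hcT : c T = rin := circlePath_period hubar hw k
  obtain ⟨ψ, hψ, hψD, hψT⟩ := exists_polar_angle_of_homotopy hT0 (H := H) (φ := φ)
    (fun p hp => by
      have h1 := (contDiffAt_gradAt (hreg p.2 hp.2 _ (hmem p.1 hp.1 p.2)).1).continuousAt
      have h2 : Continuous fun p : ℝ × ℝ => (p.2, rin + (p.1 : ℂ) * (c p.2 - rin)) := by fun_prop
      exact (h1.comp (f := fun p : ℝ × ℝ => (p.2, rin + (p.1 : ℂ) * (c p.2 - rin)))
        h2.continuousAt).continuousWithinAt)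
    (fun p hp => (hreg p.2 hp.2 _ (hmem p.1 hp.1 p.2)).2)
    (fun s _ => by simp [hH, hc0]) (fun s _ => by simp [hH, hcT]) hφ
    (fun t ht => by simpa [hH, gradAt] using hφD t ht)
  have hnormal : ∀ t ∈ Icc 0 T, normal D t (c t) = dir (ψ t) := by
    intro t ht
    have h1 := hψD t ht
    have e : H (1, t) = grad D t (c t) := by simp [hH, gradAt]
    have h2 : H (1, t) ≠ 0 := (hreg t ht _ (hmem 1 ⟨zero_le_one, le_rfl⟩ t)).2
    have h3 : (‖H (1, t)‖ : ℂ) ≠ 0 := by exact_mod_cast (norm_pos_iff.2 h2).ne'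
    rw [normal, ← e]
    nth_rewrite 2 [h1]
    rw [← mul_assoc, inv_mul_cancel₀ h3, one_mul]
  -- The heading relative to the gradient changes by at least `2πk - 2π(k - 1) = 2π`, so it attains
  -- every value modulo `2π`.
  set g : ℝ → ℝ := fun t => θin + w * t - ψ t with hg
  have hgc : ContinuousOn g (Icc 0 T) := (by fun_prop : Continuous fun t => θin + w * t).continuousOn.sub hψ
  have hinc : ∃ j : ℤ, a + j * (2 * Real.pi) ∈ g '' Icc 0 T := by
    have hwT : ubar * T = 2 * Real.pi * k := by rw [hT]; field_simp
    have hψT' := abs_le.1 hφT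
    rw [← hψT] at hψT'
    rcases hw with rfl | rfl
    · obtain ⟨j, hj⟩ := exists_mem_Icc_add_int_mul (x := g 0) (y := g T) (by
        simp only [hg]; linarith [hψT'.2]) a
      exact ⟨j, intermediate_value_Icc hT0 hgc hj⟩
    · obtain ⟨j, hj⟩ := exists_mem_Icc_add_int_mul (x := g T) (y := g 0) (by
        simp only [hg]; linarith [hψT'.1]) a
      exact ⟨j, intermediate_value_Icc' hT0 hgc hj⟩
  obtain ⟨j, t, ht, hgt⟩ := hinc
  refine ⟨t, ht, ?_⟩
  rw [hnormal t ht, ← dir_add_int_mul a j, ← hgt, ← dir_add]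
  simp [hg]

end Rotation

/-! ### Reaching the attracting part of the surface -/

section Arrival

variable {D : ℝ → ℂ → ℝ} {q : ℝ × ℂ} {t : ℝ} {r : ℝ → ℂ} {θ u : ℝ → ℝ} {J : Set ℝ}
  {v γ δ d₀ ubar dlo dhi θin τ w : ℝ} {rin : ℂ}

/-- The vehicle moves along the circle while the switching quantity has a constant sign. -/
lemma Motion.eq_circlePath (hM : Motion D v ubar γ δ d₀ θin τ r θ u) {e a b : ℝ}
    (he : e ∈ ({1, -1} : Set ℝ)) (hw : w = -e * ubar) (hw0 : w ≠ 0) (ha : 0 ≤ a) (hb : b ≤ τ)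
    (hS : ∀ t ∈ Ioo a b, Regular D (t, r t) ∧ 0 < e * switch D v γ δ d₀ (t, r t) (θ t))
    (hθa : θ a = θin + w * a) (hra : r a = circlePath v rin θin w a) :
    ∀ t ∈ Icc a b, θ t = θin + w * t ∧ r t = circlePath v rin θin w t := by
  have hθ : ∀ t ∈ Icc a b, θ t = θin + w * t := fun t ht => by
    rw [hM.heading_eq he ha hb hS t ht, hθa, hw]; ring
  have hsub : Icc a b ⊆ Icc 0 τ := Icc_subset_Icc ha hb
  have hder : ∀ s ∈ Icc a b, HasDerivWithinAt (fun s => r s - circlePath v rin θin w s) 0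
      (Icc a b) s := fun s hs => by
    have h := ((hM.velocity s (hsub hs)).mono hsub).sub
      (hasDerivAt_circlePath (rin := rin) (θin := θin) (v := v) hw0 s).hasDerivWithinAt
    exact h.congr_deriv (by rw [hθ s hs, sub_self])
  have hconst := constant_of_has_deriv_right_zero
    (fun s hs => (hder s hs).continuousWithinAt)
    (fun s hs => (hder s (Ico_subset_Icc_self hs)).mono_of_mem_nhdsWithin
      (Icc_mem_nhdsGE_of_mem hs))
  refine fun t ht => ⟨hθ t ht, ?_⟩
  have := hconst t ht
  simp only [hra, sub_self] at this
  exact sub_eq_zero.1 this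

lemma exists_first_zero {f : ℝ → ℝ} {a b : ℝ} (hab : a ≤ b) (hf : ContinuousOn f (Icc a b))
    (ha : 0 < f a) (hb : f b ≤ 0) :
    ∃ c ∈ Ioc a b, f c = 0 ∧ ∀ x ∈ Ico a c, 0 < f x := by
  have hcl : IsClosed (Icc a b ∩ f ⁻¹' Iic 0) := hf.preimage_isClosed_of_isClosed isClosed_Icc
    isClosed_Iic
  obtain ⟨c, hc⟩ := (isCompact_Icc.of_isClosed_subset hcl inter_subset_left).exists_isLeast
    ⟨b, ⟨right_mem_Icc.2 hab, hb⟩⟩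
  have hpos : ∀ x ∈ Ico a c, 0 < f x := fun x hx => by
    by_contra h
    exact absurd (hc.2 ⟨⟨hx.1, hx.2.le.trans hc.1.1.2⟩, not_lt.1 h⟩) (not_le.2 hx.2)
  refine ⟨c, ⟨lt_of_le_of_ne hc.1.1.1 ?_, hc.1.1.2⟩, ?_, hpos⟩
  · rintro rfl
    exact absurd ha (not_lt.2 hc.1.2)
  · obtain ⟨x, hx, hx0⟩ := intermediate_value_Icc' hc.1.1.1
      (hf.mono (Icc_subset_Icc_right hc.1.1.2)) ⟨hc.1.2, ha.le⟩
    rcases hx.2.eq_or_lt with rfl | hlt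
    · exact hx0
    · exact absurd hx0 (hpos x ⟨hx.1, hlt⟩).ne'

/-- The vehicle that moves along the circle arrives at the attracting part of the discontinuity
surface. -/
lemma steer_pos_of_arrival (hc : Controlled D dlo dhi v ubar γ δ d₀) {e a b : ℝ}
    (he : e ∈ ({1, -1} : Set ℝ)) (hw : w = -e * ubar) (hw0 : w ≠ 0) (hab : a < b)
    (hz : (b, circlePath v rin θin w b) ∈ zone D dlo dhi)
    (h0 : switch D v γ δ d₀ (b, circlePath v rin θin w b) (θin + w * b) = 0)
    (hpos : ∀ t ∈ Ico a b,
      0 < e * switch D v γ δ d₀ (t, circlePath v rin θin w t) (θin + w * t)) :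
    0 < steer D v (b, circlePath v rin θin w b) (θin + w * b) := by
  -- If `Q < 0` at `b`, the control `-e ubar` makes `e S` increase just before `b`, so it could not
  -- come down from positive values to zero.
  refine lt_of_le_of_ne (not_lt.1 fun hneg => ?_) (hc.steer_ne_zero hz h0).symm
  set c := circlePath v rin θin w with hcdef
  have hder := hasDerivAt_circlePath (v := v) (rin := rin) (θin := θin) hw0
  have hcc : ContinuousWithinAt c univ b := (hder b).continuousAt.continuousWithinAt
  have hθc : ContinuousWithinAt (fun t => θin + w * t) univ b := by fun_prop
  have hev := (hc.eventually_dominated hcc hθc hz h0).and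
    ((continuousWithinAt_steer hcc hθc (hc.regular _ hz) v).eventually_lt_const hneg)
  rw [nhdsWithin_univ] at hev
  obtain ⟨l, hl, hls⟩ := exists_Ioc_subset_of_mem_nhds hev ⟨a, hab⟩
  obtain ⟨m₀, hm₀l, hm₀b⟩ := exists_between (max_lt hl hab)
  have hsub : Icc m₀ b ⊆ Ioc l b := fun x hx =>
    ⟨((le_max_left _ _).trans_lt hm₀l).trans_le hx.1, hx.2⟩
  obtain ⟨x, hx, m, hm0, hm, hxe⟩ := exists_switch_sub (D := D) (r := c)
    (θ := fun t => θin + w * t) (v := v) (d₀ := d₀) hc.gamma_pos hc.delta_pos (c := w) hm₀b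
    (fun s _ => (hder s).hasDerivWithinAt)
    (fun s _ => (hasDerivAt_affine θin w s).hasDerivWithinAt)
    (fun s hs => (hls (hsub hs)).1.1)
  obtain ⟨⟨-, h1⟩, h2⟩ := hls (hsub (Ioo_subset_Icc_self hx))
  have h3 := hpos m₀ ⟨(le_max_right _ _).trans hm₀l.le, hm₀b⟩
  have hlen : 0 < b - m₀ := sub_pos.2 hm₀b
  simp only [h0] at hxe
  rcases he with rfl | rfl
  · have := dominated_sign (w := w) hm0 hm h1 (by rw [abs_of_neg h2, hw]; ring)
    nlinarith
  · have := dominated_sign (P := -drift D v (x, c x) (θin + w * x))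
      (F := -flow D v (x, c x) (θin + w * x)) (w := -w) hm0 hm (by simpa using h1)
      (by rw [abs_of_neg h2, hw]; ring)
    nlinarith

/-- The vehicle that starts outside the discontinuity surface arrives at its attracting part
while moving along the initial circle. -/
lemma Motion.exists_arrival (hc : Controlled D dlo dhi v ubar γ δ d₀) (hv : 0 < v)
    (hM : Motion D v ubar γ δ d₀ θin τ r θ u) (hr0 : r 0 = rin) {e ε : ℝ}
    (he : e ∈ ({1, -1} : Set ℝ)) (hε : 0 < ε) (hετ : ε ≤ τ)
    (hS : ∀ t ∈ Ioo 0 ε, Regular D (t, r t) ∧ 0 < e * switch D v γ δ d₀ (t, r t) (θ t))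
    (hS0 : 0 ≤ e * switch D v γ δ d₀ (0, r 0) (θ 0)) {k : ℕ}
    (hrot : GradientRotationLE D rin (2 * Real.pi * k / ubar) (2 * Real.pi * ((k : ℝ) - 1)))
    (hdisc : ∀ t ∈ Icc (0 : ℝ) (2 * Real.pi * k / ubar), ∀ w ∈ ({ubar, -ubar} : Set ℝ),
      ∀ x ∈ initialDisc v rin θin w, (t, x) ∈ zone D dlo dhi) :
    ∃ t₀ ∈ Icc (0 : ℝ) (2 * Real.pi * k / ubar),
      (∀ t ∈ Icc 0 τ, t ≤ t₀ → (t, r t) ∈ zone D dlo dhi) ∧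
      (t₀ ≤ τ → switch D v γ δ d₀ (t₀, r t₀) (θ t₀) = 0 ∧ 0 < steer D v (t₀, r t₀) (θ t₀)) := by
  set T := 2 * Real.pi * k / ubar with hT
  have hτ : 0 ≤ τ := hε.le.trans hετ
  have hubar := hc.ubar_pos
  set w := -e * ubar with hw
  have hwm : w ∈ ({ubar, -ubar} : Set ℝ) := by
    rcases he with h | h
    · right; rw [hw, h]; simp
    · left; rw [hw, h]; simp
  have hw0 : w ≠ 0 := by
    rcases hwm with h | h <;> rw [h] <;> [exact hubar.ne'; exact neg_ne_zero.2 hubar.ne']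
  have hθ0 : θ 0 = θin + w * 0 := by simp [hM.heading 0 ⟨le_rfl, hτ⟩]
  set c := circlePath v rin θin w with hcdef
  have hcc : Continuous c := continuous_iff_continuousAt.2 fun t =>
    (hasDerivAt_circlePath hw0 t).continuousAt
  have hcz : ∀ t ∈ Icc 0 T, (t, c t) ∈ zone D dlo dhi := fun t ht =>
    hdisc t ht w hwm _ (circlePath_mem hv t)
  have hrc0 : r 0 = c 0 := by rw [hr0, hcdef, circlePath_zero]
  have hstart : ∀ t ∈ Icc 0 ε, θ t = θin + w * t ∧ r t = c t :=
    hM.eq_circlePath he hw hw0 le_rfl hετ hS hθ0 hrc0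
  set f : ℝ → ℝ := fun t => e * switch D v γ δ d₀ (t, c t) (θin + w * t) with hf
  have hfc : ContinuousOn f (Icc 0 T) := fun t ht => continuousWithinAt_const.mul
    (continuousWithinAt_switch hcc.continuousWithinAt (by fun_prop) (hc.regular _ (hcz t ht))
      hc.delta_pos v γ d₀)
  have hfpos : ∀ t ∈ Ioo 0 ε, 0 < f t := fun t ht => by
    have h1 := hstart t (Ioo_subset_Icc_self ht)
    have h2 := (hS t ht).2
    rwa [h1.1, h1.2] at h2
  have hf0 : 0 ≤ f 0 := by rwa [hθ0, hrc0] at hS0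
  obtain ⟨t₁, ht₁, hft₁⟩ : ∃ t₁ ∈ Icc 0 T, f t₁ < 0 := by
    have hrots := exists_dir_eq_normal hv hubar hwm hrot
      (fun t ht x hx => hc.regular _ (hdisc t ht w hwm x hx))
    rcases he with rfl | rfl
    · obtain ⟨t, ht, htn⟩ := hrots Real.pi
      have h := hc.switch_neg _ (hcz t ht) (θin + w * t) (by
        rw [htn]; simp [dir, hcdef])
      exact ⟨t, ht, by simpa [hf] using h⟩
    · obtain ⟨t, ht, htn⟩ := hrots 0
      have h := hc.switch_pos _ (hcz t ht) (θin + w * t) (by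
        rw [htn]; simp [dir, hcdef])
      exact ⟨t, ht, by simpa [hf] using h⟩
  have ht₁ε : ε ≤ t₁ := by
    by_contra hlt
    rcases ht₁.1.eq_or_lt with h | h
    · rw [← h] at hft₁; linarith
    · exact absurd (hfpos t₁ ⟨h, not_le.1 hlt⟩) (not_lt.2 hft₁.le)
  -- The search starts at `ε / 2` because `f` may vanish at `0`, when the motion begins on the
  -- repelling part.
  obtain ⟨t₀, ht₀, hft₀, hft₀pos⟩ := exists_first_zero (f := f) (a := ε / 2) (b := t₁)
    (by linarith) (hfc.mono (Icc_subset_Icc (by linarith) ht₁.2))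
    (hfpos _ ⟨by linarith, by linarith⟩) hft₁.le
  have ht₀T : t₀ ∈ Icc 0 T := ⟨by linarith [ht₀.1], ht₀.2.trans ht₁.2⟩
  have hfpos' : ∀ t ∈ Ioo 0 t₀, 0 < f t := fun t ht => by
    rcases lt_or_ge t ε with h | h
    · exact hfpos t ⟨ht.1, h⟩
    · exact hft₀pos t ⟨by linarith, ht.2⟩
  have hSt₀ : switch D v γ δ d₀ (t₀, c t₀) (θin + w * t₀) = 0 := by
    rcases mul_eq_zero.1 hft₀ with h | h
    · rcases he with rfl | rfl <;> norm_num at h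
    · exact h
  have hQ := steer_pos_of_arrival hc he hw hw0 ht₀.1 (hcz t₀ ht₀T) hSt₀ hft₀pos
  have hrcont := hM.continuousOn_position
  have hθcont := hM.continuousOn_heading hτ
  -- So far `f` describes only the virtual circular motion. The actual one coincides with it up to
  -- `t₀` by continuation: where they agree before `t₀`, the sign of `S` persists for a while and
  -- fixes the control.
  have hfollow : Icc 0 (min t₀ τ) ⊆ {t | θ t = θin + w * t ∧ r t = c t} := by
    refine IsClosed.Icc_subset_of_forall_mem_nhdsWithin ?_ ⟨hθ0, hrc0⟩ ?_
    · have hcl : IsClosed (Icc 0 (min t₀ τ) ∩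
          (fun t => (θ t - (θin + w * t), r t - c t)) ⁻¹' {0}) := by
        refine ContinuousOn.preimage_isClosed_of_isClosed ?_ isClosed_Icc isClosed_singleton
        exact ContinuousOn.mono (s := Icc 0 τ)
          ((hθcont.sub (by fun_prop)).prodMk (hrcont.sub hcc.continuousOn))
          (Icc_subset_Icc_right (min_le_right _ _))
      convert hcl using 1
      ext t
      simp [sub_eq_zero, and_comm]
    · rintro t ⟨⟨hθt, hrt⟩, ht⟩
      rcases ht.1.eq_or_lt with h | h
      · rw [← h]
        exact mem_of_superset (Ioc_mem_nhdsGT hε) fun s hs => hstart s (Ioc_subset_Icc_self hs)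
      have htτ : t < τ := ht.2.trans_le (min_le_right _ _)
      have htt₀ : t < t₀ := ht.2.trans_le (min_le_left _ _)
      have hR : Regular D (t, r t) := by
        rw [hrt]; exact hc.regular _ (hcz t ⟨h.le, htt₀.le.trans ht₀T.2⟩)
      have hpos : 0 < e * switch D v γ δ d₀ (t, r t) (θ t) := by
        rw [hrt, hθt]; exact hfpos' t ⟨h, htt₀⟩
      have htI : t ∈ Icc 0 τ := ⟨h.le, htτ.le⟩
      have hev := (eventually_regular (hrcont t htI) hR).and ((continuousWithinAt_const.mul
        (continuousWithinAt_switch (hrcont t htI) (hθcont t htI) hR hc.delta_pos v γ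
          d₀)).eventually_const_lt hpos)
      have hev' := hev.filter_mono (nhdsWithin_mono t (Icc_subset_Icc_left h.le))
      rw [nhdsWithin_Icc_eq_nhdsGE htτ] at hev'
      obtain ⟨b, hb1, hb2⟩ := (mem_nhdsGE_iff_exists_Icc_subset).1 hev'
      have hb : t < min b τ := lt_min hb1 htτ
      refine mem_of_superset (Ioc_mem_nhdsGT hb) fun s hs => ?_
      exact hM.eq_circlePath he hw hw0 h.le (min_le_right b τ)
        (fun x hx => hb2 ⟨hx.1.le, hx.2.le.trans (min_le_left _ _)⟩) hθt hrt s
        (Ioc_subset_Icc_self hs)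
  refine ⟨t₀, ht₀T, fun t ht htt₀ => ?_, fun ht₀τ => ?_⟩
  · rw [(hfollow ⟨ht.1, le_min htt₀ ht.2⟩).2]
    exact hcz t ⟨ht.1, htt₀.trans ht₀T.2⟩
  · obtain ⟨h1, h2⟩ := hfollow ⟨ht₀T.1, le_min le_rfl ht₀τ⟩
    rw [h1, h2]
    exact ⟨hSt₀, hQ⟩

lemma switching_eq (hu : UniqueDiffWithinAt ℝ J t)
    (hr : HasDerivWithinAt r (v * dir (θ t)) J t) (hR : Regular D (t, r t)) :
    switching D γ δ d₀ J r t = switch D v γ δ d₀ (t, r t) (θ t) := by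
  have h := (hasDerivWithinAt_field hr hR).derivWithin hu
  simp only [switching, switch, ← h]
  rfl

lemma IsMotion.motion (hM : IsMotion D v ubar γ δ d₀ rin θin J r θ u) (hu : UniqueDiffOn ℝ J)
    (hJ : Icc 0 τ ⊆ J) (hτ : 0 ≤ τ) : Motion D v ubar γ δ d₀ θin τ r θ u where
  velocity t ht := (hM.velocity t (hJ ht)).mono hJ
  integrable := hM.integrable τ (hJ ⟨hτ, le_rfl⟩)
  heading t ht := hM.heading t (hJ ht)
  law_pos := by
    filter_upwards [ae_imp_of_ae_restrict hM.law_pos] with t h ht hR hS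
    exact h (hJ ht) (by rwa [switching_eq (hu t (hJ ht)) (hM.velocity t (hJ ht)) hR])
  law_neg := by
    filter_upwards [ae_imp_of_ae_restrict hM.law_neg] with t h ht hR hS
    exact h (hJ ht) (by rwa [switching_eq (hu t (hJ ht)) (hM.velocity t (hJ ht)) hR])

lemma exists_constant_sign {f : ℝ → ℝ} {ε : ℝ} (hf : ContinuousOn f (Ioo 0 ε))
    (h0 : ∀ t ∈ Ioo 0 ε, f t ≠ 0) : ∃ e ∈ ({1, -1} : Set ℝ), ∀ t ∈ Ioo 0 ε, 0 < e * f t := by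
  by_contra hcon
  push Not at hcon
  obtain ⟨a, ha, ha'⟩ := hcon 1 (by simp)
  obtain ⟨b, hb, hb'⟩ := hcon (-1) (by simp)
  obtain ⟨x, hx, hx0⟩ := isPreconnected_Ioo.intermediate_value ha hb hf
    (show (0 : ℝ) ∈ Icc (f a) (f b) from ⟨by linarith, by linarith⟩)
  exact h0 x hx hx0

/-- After a transient of a bounded duration, the vehicle slides over the discontinuity surface; it
does not leave the operational zone. -/
theorem IsMotion.exists_sliding (hc : Controlled D dlo dhi v ubar γ δ d₀) (hv : 0 < v)
    (hM : IsMotion D v ubar γ δ d₀ rin θin J r θ u) (hN : NoRepellingStart D γ δ d₀ rin θin J r)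
    (hu : UniqueDiffOn ℝ J) (hJ : Icc 0 τ ⊆ J) (hτ : 0 < τ) {k : ℕ}
    (hrot : GradientRotationLE D rin (2 * Real.pi * k / ubar) (2 * Real.pi * ((k : ℝ) - 1)))
    (hdisc : ∀ t ∈ Icc (0 : ℝ) (2 * Real.pi * k / ubar), ∀ w ∈ ({ubar, -ubar} : Set ℝ),
      ∀ x ∈ initialDisc v rin θin w, (t, x) ∈ zone D dlo dhi) :
    ∃ t₀ ∈ Icc (0 : ℝ) (2 * Real.pi * k / ubar),
      (∀ t ∈ Icc 0 τ, t ≤ t₀ → (t, r t) ∈ zone D dlo dhi) ∧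
      ∀ t ∈ Icc t₀ τ, (t, r t) ∈ zone D dlo dhi ∧ switch D v γ δ d₀ (t, r t) (θ t) = 0 := by
  have hubar := hc.ubar_pos
  have hM' := hM.motion hu hJ hτ.le
  have h0T : (0 : ℝ) ∈ Icc 0 (2 * Real.pi * k / ubar) := ⟨le_rfl, by positivity⟩
  have h0 : (0 : ℝ) ∈ Icc 0 τ := ⟨le_rfl, hτ.le⟩
  have hθ0 : θ 0 = θin := by simp [hM.heading 0 (hJ h0)]
  have hz0 : (0, r 0) ∈ zone D dlo dhi := by
    rw [hM.initial]
    have h1 := hdisc 0 h0T ubar (by simp) _ (circlePath_mem hv 0)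
    rwa [circlePath_zero] at h1
  have hR0 := hc.regular _ hz0
  have hrc := hM'.continuousOn_position
  have hθc := hM'.continuousOn_heading hτ.le
  obtain ⟨η, hη, hηR⟩ : ∃ η ∈ Ioc 0 τ, ∀ s ∈ Icc 0 η, Regular D (s, r s) := by
    have hev := eventually_regular (hrc 0 h0) hR0
    rw [nhdsWithin_Icc_eq_nhdsGE hτ] at hev
    obtain ⟨b, hb1, hb2⟩ := (mem_nhdsGE_iff_exists_Icc_subset).1 hev
    exact ⟨min b τ, ⟨lt_min hb1 hτ, min_le_right _ _⟩,
      fun s hs => hb2 ⟨hs.1, hs.2.trans (min_le_left _ _)⟩⟩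
  have hsub : Icc 0 η ⊆ Icc 0 τ := Icc_subset_Icc_right hη.2
  have hScont : ContinuousOn (fun s => switch D v γ δ d₀ (s, r s) (θ s)) (Icc 0 η) := fun s hs =>
    continuousWithinAt_switch ((hrc s (hsub hs)).mono hsub) ((hθc s (hsub hs)).mono hsub)
      (hηR s hs) hc.delta_pos v γ d₀
  have hswitching : ∀ s ∈ Icc 0 η,
      switching D γ δ d₀ J r s = switch D v γ δ d₀ (s, r s) (θ s) := fun s hs =>
    switching_eq (hu s (hJ (hsub hs))) (hM.velocity s (hJ (hsub hs))) (hηR s hs)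
  have h0η : (0 : ℝ) ∈ Icc 0 η := ⟨le_rfl, hη.1.le⟩
  -- Sliding at once is one case. Otherwise `S` is nonzero right after the start: by continuity if
  -- `S ≠ 0` at `0`, and by the assumption on repelling starts if `S = 0` with `Q < 0`.
  by_cases hslide : switch D v γ δ d₀ (0, r 0) (θ 0) = 0 ∧ 0 < steer D v (0, r 0) (θ 0)
  · refine ⟨0, h0T, fun t ht ht0 => ?_, hM'.sliding hc h0 hz0 hslide.1 hslide.2⟩
    rwa [le_antisymm ht0 ht.1]
  have hleave : ∃ ε ∈ Ioc 0 η, ∀ t ∈ Ioo 0 ε, switch D v γ δ d₀ (t, r t) (θ t) ≠ 0 := by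
    by_cases hS0 : switch D v γ δ d₀ (0, r 0) (θ 0) = 0
    · have hQ : steer D v (0, r 0) (θ 0) < 0 :=
        lt_of_le_of_ne (not_lt.1 fun h => hslide ⟨hS0, h⟩) (hc.steer_ne_zero hz0 hS0)
      rw [steer_eq hR0, hθ0] at hQ
      have hin : inner ℝ (dir θin) (tangent D 0 (r 0)) < 0 := by
        by_contra h
        exact absurd hQ (not_lt.2 (mul_nonneg (norm_nonneg _) (mul_nonneg hv.le (not_lt.1 h))))
      obtain ⟨ε, hε, hεS⟩ := hN (by rw [hswitching 0 h0η, hS0]) (by rwa [← hM.initial])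
      refine ⟨min ε η, ⟨lt_min hε hη.1, min_le_right _ _⟩, fun t ht => ?_⟩
      have htη : t ∈ Icc 0 η := ⟨ht.1.le, ht.2.le.trans (min_le_right _ _)⟩
      rw [← hswitching t htη]
      exact hεS t (hJ (hsub htη)) ht.1 (ht.2.trans_le (min_le_left _ _))
    · have hev := (hScont 0 h0η).eventually_ne hS0
      rw [nhdsWithin_Icc_eq_nhdsGE hη.1] at hev
      obtain ⟨b, hb1, hb2⟩ := (mem_nhdsGE_iff_exists_Icc_subset).1 hev
      exact ⟨min b η, ⟨lt_min hb1 hη.1, min_le_right _ _⟩,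
        fun t ht => hb2 ⟨ht.1.le, ht.2.le.trans (min_le_left _ _)⟩⟩
  obtain ⟨ε, hε, hεS⟩ := hleave
  have hsubε : Icc 0 ε ⊆ Icc 0 η := Icc_subset_Icc_right hε.2
  obtain ⟨e, he, hpos⟩ := exists_constant_sign
    (hScont.mono (Ioo_subset_Icc_self.trans hsubε)) hεS
  have hS0 : 0 ≤ e * switch D v γ δ d₀ (0, r 0) (θ 0) := by
    have h1 := ((hScont 0 h0η).mono (Ioo_subset_Icc_self.trans hsubε)).const_smul e
    have hne : (𝓝[Ioo 0 ε] (0 : ℝ)).NeBot := by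
      rw [nhdsWithin_Ioo_eq_nhdsGT hε.1]; infer_instance
    refine ge_of_tendsto h1.tendsto ?_
    filter_upwards [self_mem_nhdsWithin] with s hs using (hpos s hs).le
  obtain ⟨t₀, ht₀, hzone, harr⟩ := hM'.exists_arrival hc hv hM.initial he hε.1
    (hε.2.trans hη.2) (fun t ht => ⟨hηR t (hsubε (Ioo_subset_Icc_self ht)), hpos t ht⟩) hS0
    hrot hdisc
  refine ⟨t₀, ht₀, hzone, fun t ht => ?_⟩
  have ht₀τ : t₀ ≤ τ := ht.1.trans ht.2
  have ht₀I : t₀ ∈ Icc 0 τ := ⟨ht₀.1, ht₀τ⟩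
  exact hM'.sliding hc ht₀I (hzone t₀ ht₀I le_rfl) (harr ht₀τ).1 (harr ht₀τ).2 t ht

end Arrival

/-! ### From the assumptions on the field and gains to `Controlled` -/

section Tuning

/-- The assumptions on the field and the choice of the gains make the discontinuity surface
attract the vehicle that travels in the positive direction relative to the isoline. -/
lemma controlled_of_gains {D : ℝ → ℂ → ℝ} {dlo dhi d₀ v ubar γ δ : ℝ} (hd_lo : dlo ≤ d₀)
    (hd_hi : d₀ ≤ dhi) (hv : 0 < v) (hubar : 0 < ubar) (hγ : 0 < γ) (hδ : 0 < δ)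
    (hclosed : IsClosed (zone D dlo dhi))
    (hsmooth : ∀ p ∈ zone D dlo dhi, ContDiffAt ℝ 2 (fun q : ℝ × ℂ => D q.1 q.2) p)
    {Δlam Δu : ℝ} (hΔlam : 0 < Δlam)
    (hspeed : ∀ t r, (t, r) ∈ zone D dlo dhi → |frontVelocity D t r| ≤ v - Δlam)
    (hturn : ∀ t r, (t, r) ∈ zone D dlo dhi → ∀ ε ∈ ({1, -1} : Set ℝ),
      |ε * (2 * angularVelocity D t r)
          + frontAcceleration D t r / √(v ^ 2 - frontVelocity D t r ^ 2)
          + curvature D t r * √(v ^ 2 - frontVelocity D t r ^ 2)| ≤ ubar - Δu)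
    {bρ : ℝ} (hbρ : 0 < bρ)
    (hgrad : ∀ t r, (t, r) ∈ zone D dlo dhi → bρ⁻¹ ≤ ‖grad D t r‖)
    {bτ bn bκ bv bα : ℝ}
    (hbounds : ∀ t r, (t, r) ∈ zone D dlo dhi →
      |tangentialRate D t r| ≤ bτ ∧ |normalRate D t r| ≤ bn ∧ |curvature D t r| ≤ bκ ∧
      |densityRate D t r| ≤ bv ∧ |frontAcceleration D t r| ≤ bα)
    {μs σ : ℝ} (hμs : μs = bρ * (γ * δ)) (hσ : σ = √(Δlam ^ 2 - 2 * v * μs - μs ^ 2))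
    (hgain₁ : 0 < μs ∧ μs < √(v ^ 2 + Δlam ^ 2) - v)
    (hgain₂ : (3 * bτ + (v * bκ + 2 * bv + γ + bn * μs) / σ + v * bα / σ ^ 3) * μs < Δu) :
    Controlled D dlo dhi v ubar γ δ d₀ := by
  have hreg : ∀ q ∈ zone D dlo dhi, Regular D q := fun q hq =>
    ⟨hsmooth q hq, norm_pos_iff.1 ((inv_pos.2 hbρ).trans_le (hgrad q.1 q.2 hq))⟩
  have hμ := hgain₁.1
  have hσpos : 0 < Δlam ^ 2 - 2 * v * μs - μs ^ 2 := by
    have h1 : μs + v < √(v ^ 2 + Δlam ^ 2) := by linarith [hgain₁.2]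
    have h2 := (Real.lt_sqrt (by positivity)).1 h1
    linarith
  have hμΔ : μs < Δlam := by nlinarith
  have hχ : ∀ q ∈ zone D dlo dhi, ∀ p, |chi γ δ p| ≤ ‖gradAt D q‖ * μs := by
    intro q hq p
    have h1 : 1 ≤ ‖gradAt D q‖ * bρ := (inv_le_iff_one_le_mul₀ hbρ).1 (hgrad q.1 q.2 hq)
    have h2 : 0 < γ * δ := mul_pos hγ hδ
    rw [hμs]
    nlinarith [abs_chi_le hγ hδ p]
  refine ⟨hγ, hδ, hubar, hd_lo, hd_hi, hclosed, hreg, ?_, ?_, ?_⟩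
  · rintro ⟨t, r⟩ hq φ hS
    have hR := hreg _ hq
    have hρ := hR.norm_pos
    obtain ⟨hτ, hn, hκ, hw, hα⟩ := hbounds t r hq
    set z := v * inner ℝ (dir φ) (normal D t r) - frontVelocity D t r with hz
    set C := v * inner ℝ (dir φ) (tangent D t r) with hC
    have hflow : flow D v (t, r) φ = ‖gradAt D (t, r)‖ * z := flow_eq hR v φ
    have hzμ : |z| ≤ μs := by
      have h1 : ‖gradAt D (t, r)‖ * |z| ≤ ‖gradAt D (t, r)‖ * μs := by
        rw [← abs_of_pos hρ, ← abs_mul, abs_of_pos hρ, ← hflow]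
        have h2 : flow D v (t, r) φ = -chi γ δ (field D (t, r) - d₀) := by
          simp only [switch] at hS; linarith
        rw [h2, abs_neg]
        exact hχ _ hq _
      exact le_of_mul_le_mul_left h1 hρ
    have hCz : C ^ 2 + (frontVelocity D t r + z) ^ 2 = v ^ 2 := by
      rw [hC, hz]
      linear_combination v ^ 2 * inner_sq_add_inner_sq hR φ
    have key := gain_inequality hv hΔlam hγ hμ (by rw [hσ, Real.sq_sqrt hσpos.le])
      (by rw [hσ]; exact Real.sqrt_pos.2 hσpos) hCz hzμ (hspeed t r hq) (hturn t r hq)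
      hτ hn hκ hw hα hgain₂
    rw [drift_eq hR v φ hz hC, hflow, steer_eq hR, ← hC, abs_mul, abs_mul, abs_mul,
      abs_of_pos hρ]
    have := mul_lt_mul_of_pos_left key hρ
    linarith
  -- With the heading `±N` one has `±ḋ = ρ(v ∓ λ) ≥ ρ Δlam > ρ μs ≥ |χ|`, so `ḋ` determines the sign
  -- of the switching quantity.
  all_goals
    rintro ⟨t, r⟩ hq φ hφ
    have hR := hreg _ hq
    have hρ := hR.norm_pos
    have hlam := abs_le.1 (hspeed t r hq)
    have h1 := abs_le.1 (hχ _ hq (field D (t, r) - d₀))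
    have hNN : inner ℝ (normal D t r) (normal D t r) = (1 : ℝ) := by
      rw [real_inner_self_eq_norm_sq, normal_norm hR, one_pow]
    rw [switch, flow_eq hR, hφ]
    simp only [inner_neg_left, hNN]
    nlinarith

end Tuning

end IsolineTracking

end

theorem mainTheorem11
    -- the field, the zone bounds, the desired field value
    (D : ℝ → ℂ → ℝ) (dlo dhi d₀ : ℝ) (hd_lo : dlo ≤ d₀) (hd_hi : d₀ ≤ dhi)
    -- the robot: speed, maximal turning rate, initial position and heading
    (v ubar : ℝ) (hv : 0 < v) (hubar : 0 < ubar) (rin : ℂ) (θin : ℝ)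
    -- the controller parameters
    (γ δ : ℝ) (hγ : 0 < γ) (hδ : 0 < δ)
    -- the zone is closed (automatic for a continuous field); the field is C² near it
    (hclosed : IsClosed (IsolineTracking.zone D dlo dhi))
    (hsmooth : ∀ p ∈ IsolineTracking.zone D dlo dhi,
      ContDiffAt ℝ 2 (fun q : ℝ × ℂ => D q.1 q.2) p)
    -- enhanced trackability of the isolines
    (Δlam Δu : ℝ) (hΔlam : 0 < Δlam) (hΔu : 0 < Δu)
    (hspeed : ∀ t r, (t, r) ∈ IsolineTracking.zone D dlo dhi →
      |IsolineTracking.frontVelocity D t r| ≤ v - Δlam)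
    (hturn : ∀ t r, (t, r) ∈ IsolineTracking.zone D dlo dhi → ∀ ε ∈ ({1, -1} : Set ℝ),
      |ε * (2 * IsolineTracking.angularVelocity D t r)
          + IsolineTracking.frontAcceleration D t r
              / √(v ^ 2 - IsolineTracking.frontVelocity D t r ^ 2)
          + IsolineTracking.curvature D t r
              * √(v ^ 2 - IsolineTracking.frontVelocity D t r ^ 2)| ≤ ubar - Δu)
    -- no spatial singularities
    (bρ : ℝ) (hbρ : 0 < bρ)
    (hgrad : ∀ t r, (t, r) ∈ IsolineTracking.zone D dlo dhi →
      bρ⁻¹ ≤ ‖IsolineTracking.grad D t r‖)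
    -- bounded characteristics of the field
    (blam bτ bn bκ bv bα : ℝ)
    (hbounds : ∀ t r, (t, r) ∈ IsolineTracking.zone D dlo dhi →
      |IsolineTracking.frontVelocity D t r| ≤ blam ∧
      |IsolineTracking.tangentialRate D t r| ≤ bτ ∧
      |IsolineTracking.normalRate D t r| ≤ bn ∧
      |IsolineTracking.curvature D t r| ≤ bκ ∧
      |IsolineTracking.densityRate D t r| ≤ bv ∧
      |IsolineTracking.frontAcceleration D t r| ≤ bα)
    -- the initial stage
    (hinit : ∃ k : ℕ,
      IsolineTracking.GradientRotationLE D rin (2 * Real.pi * k / ubar)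
        (2 * Real.pi * ((k : ℝ) - 1)) ∧
      ∀ t ∈ Set.Icc (0 : ℝ) (2 * Real.pi * k / ubar), ∀ u ∈ ({ubar, -ubar} : Set ℝ),
        ∀ r ∈ IsolineTracking.initialDisc v rin θin u,
          (t, r) ∈ IsolineTracking.zone D dlo dhi)
    -- the choice of the gains
    (μs σ : ℝ) (hμs : μs = bρ * (γ * δ)) (hσ : σ = √(Δlam ^ 2 - 2 * v * μs - μs ^ 2))
    (hgain₁ : 0 < μs ∧ μs < √(v ^ 2 + Δlam ^ 2) - v)
    (hgain₂ : (3 * bτ + (v * bκ + 2 * bv + γ + bn * μs) / σ + v * bα / σ ^ 3) * μs < Δu) :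
    -- a motion never leaves the zone, on whatever time interval it is defined
    (∀ τ : ℝ, 0 < τ → ∀ (r : ℝ → ℂ) (θ u : ℝ → ℝ),
      IsolineTracking.IsMotion D v ubar γ δ d₀ rin θin (Set.Icc 0 τ) r θ u →
      IsolineTracking.NoRepellingStart D γ δ d₀ rin θin (Set.Icc 0 τ) r →
      ∀ t ∈ Set.Icc 0 τ, (t, r t) ∈ IsolineTracking.zone D dlo dhi) ∧
    -- a motion defined for all times stays in the zone and achieves the control objective
    (∀ (r : ℝ → ℂ) (θ u : ℝ → ℝ),
      IsolineTracking.IsMotion D v ubar γ δ d₀ rin θin (Set.Ici 0) r θ u →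
      IsolineTracking.NoRepellingStart D γ δ d₀ rin θin (Set.Ici 0) r →
      (∀ t ∈ Set.Ici (0 : ℝ), (t, r t) ∈ IsolineTracking.zone D dlo dhi) ∧
      Filter.Tendsto (IsolineTracking.reading D r) Filter.atTop (𝓝 d₀)) := by
  have hc : IsolineTracking.Controlled D dlo dhi v ubar γ δ d₀ :=
    IsolineTracking.controlled_of_gains hd_lo hd_hi hv hubar hγ hδ hclosed hsmooth hΔlam hspeed
      hturn hbρ hgrad (fun t r h => (hbounds t r h).2) hμs hσ hgain₁ hgain₂
  obtain ⟨k, hrot, hdisc⟩ := hinit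
  have huIci : UniqueDiffOn ℝ (Set.Ici (0 : ℝ)) := uniqueDiffOn_Ici 0
  refine ⟨fun τ hτ r θ u hM hN t ht => ?_, fun r θ u hM hN => ?_⟩
  · obtain ⟨t₀, -, h1, h2⟩ :=
      hM.exists_sliding hc hv hN (uniqueDiffOn_Icc hτ) subset_rfl hτ hrot hdisc
    rcases le_total t t₀ with h | h
    · exact h1 t ht h
    · exact (h2 t ⟨h, ht.2⟩).1
  · have hslide : ∀ τ : ℝ, 0 < τ → _ := fun τ hτ =>
      hM.exists_sliding hc hv hN huIci (τ := τ) Set.Icc_subset_Ici_self hτ hrot hdisc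
    have hzone : ∀ t ∈ Set.Ici (0 : ℝ), (t, r t) ∈ IsolineTracking.zone D dlo dhi := by
      intro t ht
      have ht0 : 0 ≤ t := ht
      -- The horizon `t + 1` is positive even at `t = 0`.
      obtain ⟨t₀, -, h1, h2⟩ := hslide (t + 1) (by linarith)
      rcases le_total t t₀ with h | h
      · exact h1 t ⟨ht0, by linarith⟩ h
      · exact (h2 t ⟨h, by linarith⟩).1
    refine ⟨hzone, ?_⟩
    set T := 2 * Real.pi * k / ubar with hT
    have hT0 : 0 ≤ T := by positivity
    -- Any bound of `|d - d₀|` over the zone that is also at least `δ` would do.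
    set B := δ + (dhi - dlo) with hB
    have hB0 : 0 < B := by linarith
    set κ := 2 * (γ * (δ / B)) with hκ
    have hκ0 : 0 < κ := by positivity
    -- The onset `t₀` of sliding is obtained separately for each horizon, but it never exceeds `T`,
    -- so the decay counted from `T` is uniform.
    have hdecay : ∀ t, T ≤ t → (IsolineTracking.reading D r t - d₀) ^ 2 ≤
        B ^ 2 * Real.exp (-κ * (t - T)) := by
      intro t ht
      have ht1 : 0 < t + 1 := by linarith
      obtain ⟨t₀, ht₀, h1, h2⟩ := hslide (t + 1) ht1
      have h3 := (hM.motion huIci Set.Icc_subset_Ici_self ht1.le).sliding_decay hc (B := B)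
        ⟨ht₀.1, by linarith [ht₀.2]⟩ (by linarith)
        (fun x hx => abs_le.2 ⟨by linarith [hx.1], by linarith [hx.2]⟩) h2 t
        ⟨ht₀.2.trans ht, by linarith⟩
      refine h3.trans ?_
      gcongr B ^ 2 * Real.exp ?_
      nlinarith [ht₀.2]
    have hlim : Filter.Tendsto (fun t : ℝ => B ^ 2 * Real.exp (-κ * (t - T))) Filter.atTop
        (𝓝 0) := by
      have h1 : Filter.Tendsto (fun t : ℝ => -κ * (t - T)) Filter.atTop Filter.atBot :=
        (Filter.tendsto_atTop_add_const_right _ (-T) Filter.tendsto_id).const_mul_atTop_of_neg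
          (neg_lt_zero.2 hκ0)
      simpa using (Real.tendsto_exp_atBot.comp h1).const_mul (B ^ 2)
    have hsq : Filter.Tendsto (fun t => (IsolineTracking.reading D r t - d₀) ^ 2) Filter.atTop
        (𝓝 0) :=
      squeeze_zero' (Filter.Eventually.of_forall fun t => sq_nonneg _)
        (Filter.eventually_atTop.2 ⟨T, hdecay⟩) hlim
    have habs := hsq.sqrt
    simp only [Real.sqrt_sq_eq_abs, Real.sqrt_zero] at habs
    exact tendsto_iff_norm_sub_tendsto_zero.2 habs
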